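/- **Setting.** Let $L,N\in\mathbb N$. The sites of the $L\times L$ periodic triangular lattice are $\mathbf r=i\,\mathbf e_1+k\,\mathbf e_3$ with $i,k\in\mathbb Z/L$; put $\mathbf e_2=\mathbf e_1+\mathbf e_3$. A *configuration* places $N$ distinguishable electrons, at positions $(\mathbf r_1,\dots,\mathbf r_N)$, and vacancies, each with an orientation $\alpha\in\{1,2,3\}$, so that every site holds exactly one electron or exactly one vacancy. The *1D vacancy dynamics* (the terms of the Hamiltonian $-t_{11}\sum_{\mathbf r,\alpha,\sigma}(f^\dagger_{\mathbf r+\mathbf e_\alpha,\sigma}f_{\mathbf r,\sigma}b^\dagger_{\mathbf r,\alpha}b_{\mathbf r+\mathbf e_\alpha,\alpha}+\mathrm{H.c.})+[U=\infty]$) consists of the moves that exchange an $\alpha$-vacancy at $\mathbf r+\mathbf e_\alpha$ with an electron at $\mathbf r$, and the reverse moves. Two configurations are *connected* if a finite sequence of moves leads from one to the other. A configuration is *even-permutation ergodic* if the permutations $\pi\in S_N$ for which it is connected to the configuration with electron positions $(\mathbf r_{\pi(1)},\dots,\mathbf r_{\pi(N)})$ and the same vacancies (same sites, same orientations) are exactly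 the even ones. The $l$-th $\alpha$-line ($1\le l\le L$) is $\{t\mathbf e_1+l\mathbf e_3\}$, $\{l\mathbf e_1+t\mathbf e_2\}$, $\{l\mathbf e_1+t\mathbf e_3\}$, $1\le t\le L$, for $\alpha=1,2,3$ respectively, and $N^{\rm v}_\alpha(l)$ is the number of $\alpha$-vacancies on it. **Canonical vacancy configuration.** By a lattice symmetry (an additive automorphism $A$ of the lattice and a permutation $\tau$ of the orientations with $A\mathbf e_\alpha=\pm\mathbf e_{\tau\alpha}$) one may assume $m_3\ge m_1\ge1$, $m_2=0$ if only two orientations are present, and $m_2\ge m_3\ge m_1\ge1$ if all three are. In that order the vacancies occupy exactly the following sites (coefficients are integers, read modulo $L$): - $\alpha=1$: $i\mathbf e_1+k\mathbf e_3$ with $1\le i\le m_1$, $m_3+1\le k\le L$, or with $m_1+1\le i\le 2m_1$, $1\le k\le m_3$; - $\alpha=3$: $i\mathbf e_1+k\mathbf e_3$ with $1\le k\le m_3$ and ($1\le i\le m_1$ or $2m_1+1\le i\le L$), or with $m_3+1\le k\le 2m_3$, $m_1+1\le i\le 2m_1$; - $\alpha=2$: $(i-1)\mathbf e_1+j\mathbf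 e_2$ with: $1\le i\le L-m_2-m_3+1$ and $L-m_2-i+2\le j\le L-i+1$; or $L-m_2-m_3+2\le i\le L-m_3$ and ($m_3+1\le j\le L+1-i$ or $2L-m_2-m_3-i+2\le j\le L$); or $L-m_3+1\le i\le L$ and $L-m_2+1\le j\le L$. For a general order, a canonical vacancy configuration is the image of such a placement under a lattice symmetry. It is understood that this prescription puts at most one vacancy on each site, so that it does define a configuration. **Proposition (Even-Permutation Ergodicity).** Let $m_1,m_2,m_3\ge0$ be integers such that a canonical vacancy configuration with these numbers exists, and consider a configuration connected to one whose vacancies are in a canonical vacancy configuration. Suppose that (a) $N^{\rm v}_\alpha(l)=m_\alpha$ for every $\alpha$ and every $l$; (b) $L-m_\alpha$ is odd for every $\alpha$ with $m_\alpha\ne0$; (c) $m_\alpha\neq0$ for at least two $\alpha$; if for exactly two, then also $2m_\alpha\le L-2$ for every $\alpha$; (d) $m_1+m_2+m_3\le L-2$. Then the configuration is even-permutation ergodic. -/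

import Mathlib

namespace Vacancy

/-- Sites of the `L × L` periodic triangular lattice; `(i, k)` is the site `i e₁ + k e₃`. -/
abbrev Site (L : ℕ) : Type := ZMod L × ZMod L

/-- The lattice vectors `e₁`, `e₂ = e₁ + e₃`, `e₃`.  The orientations `α = 1, 2, 3` are the
elements `0, 1, 2` of `Fin 3`. -/
def e (L : ℕ) : Fin 3 → Site L := ![(1, 0), (1, 1), (0, 1)]

/-- A vacancy configuration: `V r = some α` when an `α`-vacancy sits at `r`, and `V r = none`
when there is no vacancy at `r`. -/
abbrev VacancyConfig (L : ℕ) : Type := Site L → Option (Fin 3)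

/-- A configuration of `N` distinguishable (Boltzmannian) electrons together with the vacancies.
Each site holds exactly one object, an electron or a vacancy. -/
@[ext]
structure Config (L N : ℕ) where
  pos : Fin N → Site L
  vac : VacancyConfig L
  pos_injective : Function.Injective pos
  vac_eq_none_iff : ∀ r, vac r = none ↔ ∃ j, pos j = r

/-- Action of a term `f†_{r + e_α} f_r b†_{r, α} b_{r + e_α, α}` of the Hamiltonian: the electron
at `r` hops to `r + e_α` while the `α`-vacancy at `r + e_α` hops to `r`. -/
def Hop {L N : ℕ} (c c' : Config L N) : Prop :=
  ∃ (r : Site L) (α : Fin 3) (j : Fin N),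
    c.pos j = r ∧ c.vac (r + e L α) = some α ∧
    c'.pos = Function.update c.pos j (r + e L α) ∧
    c'.vac = Function.update (Function.update c.vac (r + e L α) none) r (some α)

/-- `c'` is reached from `c` by repeated applications of the terms of the Hamiltonian
and of their Hermitian conjugates. -/
def Connected {L N : ℕ} : Config L N → Config L N → Prop :=
  Relation.ReflTransGen fun c c' => Hop c c' ∨ Hop c' c

/-- The permuted configuration `(r_{π(1)}, …, r_{π(N)})`, with the same vacancies. -/
def Config.permute {L N : ℕ} (c : Config L N) (π : Equiv.Perm (Fin N)) : Config L N where
  pos := c.pos ∘ π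
  vac := c.vac
  pos_injective := c.pos_injective.comp π.injective
  vac_eq_none_iff r := by
    rw [c.vac_eq_none_iff r]
    constructor
    · rintro ⟨j, hj⟩
      exact ⟨π.symm j, by simpa using hj⟩
    · rintro ⟨j, hj⟩
      exact ⟨π j, hj⟩

/-- The permutations of the electrons induced by the dynamics are exactly the even ones. -/
def EvenPermutationErgodic {L N : ℕ} (c : Config L N) : Prop :=
  ∀ π : Equiv.Perm (Fin N), Connected c (c.permute π) ↔ π ∈ alternatingGroup (Fin N)

/-- The `t`-th site of the `l`-th `α`-line: `t e₁ + l e₃`, `l e₁ + t e₂`, `l e₁ + t e₃`. -/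
def lineSite (L : ℕ) (α : Fin 3) (l t : ℕ) : Site L :=
  ![t • e L 0 + l • e L 2, l • e L 0 + t • e L 1, l • e L 0 + t • e L 2] α

/-- The number of `α`-vacancies on the `l`-th `α`-line. -/
def lineCount {L : ℕ} (V : VacancyConfig L) (α : Fin 3) (l : ℕ) : ℕ :=
  ((Finset.Icc 1 L).filter fun t => V (lineSite L α l t) = some α).card

/-- The sites of the `α`-vacancies in the canonical placement, when the vacancy numbers per line
`m₁, m₂, m₃` are in canonical order.  Here `i`, `j`, `k` are integers. -/
def canonicalSites (L : ℕ) (m₁ m₂ m₃ : ℤ) : Fin 3 → Set (Site L) :=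
  ![{r | ∃ i k : ℤ, r = i • e L 0 + k • e L 2 ∧
      ((m₃ + 1 ≤ k ∧ k ≤ L ∧ 1 ≤ i ∧ i ≤ m₁) ∨
       (1 ≤ k ∧ k ≤ m₃ ∧ m₁ + 1 ≤ i ∧ i ≤ 2 * m₁))},
    {r | ∃ i j : ℤ, r = (i - 1) • e L 0 + j • e L 1 ∧
      ((1 ≤ i ∧ i ≤ L - m₂ - m₃ + 1 ∧ L - m₂ - i + 2 ≤ j ∧ j ≤ L - i + 1) ∨
       (L - m₂ - m₃ + 2 ≤ i ∧ i ≤ L - m₃ ∧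
         ((m₃ + 1 ≤ j ∧ j ≤ L + 1 - i) ∨ (2 * L - m₂ - m₃ - i + 2 ≤ j ∧ j ≤ L))) ∨
       (L - m₃ + 1 ≤ i ∧ i ≤ L ∧ L - m₂ + 1 ≤ j ∧ j ≤ L))},
    {r | ∃ i k : ℤ, r = i • e L 0 + k • e L 2 ∧
      ((((1 ≤ i ∧ i ≤ m₁) ∨ (2 * m₁ + 1 ≤ i ∧ i ≤ L)) ∧ 1 ≤ k ∧ k ≤ m₃) ∨
       (m₁ + 1 ≤ i ∧ i ≤ 2 * m₁ ∧ m₃ + 1 ≤ k ∧ k ≤ 2 * m₃))}]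

/-- Canonical order of the vacancy numbers: `m₃ ≥ m₁ ≥ 1` and `m₂ = 0` if two orientations are
present, `m₂ ≥ m₃ ≥ m₁ ≥ 1` if all three are. -/
def CanonicalOrder (m : Fin 3 → ℕ) : Prop :=
  (m 1 = 0 ∧ 1 ≤ m 0 ∧ m 0 ≤ m 2) ∨ (1 ≤ m 0 ∧ m 0 ≤ m 2 ∧ m 2 ≤ m 1)

/-- A symmetry of the lattice that takes `α`-lines to `τ α`-lines. -/
def IsLatticeSymmetry {L : ℕ} (A : Site L ≃+ Site L) (τ : Equiv.Perm (Fin 3)) : Prop :=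
  ∀ α, A (e L α) = e L (τ α) ∨ A (e L α) = -e L (τ α)

/-- `V` is a canonical vacancy configuration with `m α` vacancies on every `α`-line.  The canonical
order is assumed without loss of generality: in general the orientations are first relabelled
by a symmetry of the lattice.  As `V r` is a single value, the canonical placement must put at most
one vacancy on each site. -/
def IsCanonical {L : ℕ} (m : Fin 3 → ℕ) (V : VacancyConfig L) : Prop :=
  ∃ (A : Site L ≃+ Site L) (τ : Equiv.Perm (Fin 3)),
    IsLatticeSymmetry A τ ∧ CanonicalOrder (fun α => m (τ α)) ∧
    ∀ r α, V (A r) = some (τ α) ↔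
      r ∈ canonicalSites L (m (τ 0)) (m (τ 1)) (m (τ 2)) α

end Vacancy

/-! Only even permutations. Order the objects of a configuration by a key: electrons by label, then
vacancies by orientation, line and position on the line. `arrangementSign` is the inversion parity
of the key as a function on the sites, times the parity of the sum of all keys. A hop transposes two
sites, which gives one sign, and lowers one vacancy key by 1, which gives another. If the hop
crosses the periodic seam, the key instead rises by L - 1 and overtakes the m_α - 1 other vacancies
of its line; since L - m_α is odd, the sign is the same. So the dynamics conserves this quantity
(`Hop.arrangementSign_eq`), while relabelling the electrons by π multiplies it by the sign of π.

All even permutations. Cut the torus open to a planar window in which 1-vacancies move horizontally,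
3-vacancies vertically, and 2-vacancies stand still. When a 1-vacancy and a 3-vacancy run through a
common site and return in turn, the net effect is the commutator of two 3-cycles with one common
point, hence a 3-cycle of the electrons at that site and at the next site in each direction
(`mem_labelGroup_of_adjacent_vacancies`). Being equal or lying on a common 3-cycle of the group is
an equivalence relation, and a single class forces the whole alternating group
(`alternatingGroup_le_of_forall_linked`).

In the canonical configuration the electrons fill a rectangle without a lower left block of
3-vacancies and an upper right block of 2-vacancies (`IsStaircase`). Trains of vacancies shift
electrons into reach of a crossing, and this links every electron to the one at (m₁ + 1, 1)
(`linked_bottom`, `linked_top`). Moves commute with relabelling, so the result passes to every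
configuration connected to the canonical one. -/

namespace Vacancy

/-! ### Subgroups that contain 3-cycles -/

section ThreeCycles

open Equiv

variable {ι : Type*} [DecidableEq ι] {G : Subgroup (Perm ι)} {a b c d e : ι}

/-- `i = j`, or `G` contains a 3-cycle that takes `i` to `j`. -/
def Linked (G : Subgroup (Perm ι)) (i j : ι) : Prop :=
  i = j ∨ ∃ k, i ≠ j ∧ j ≠ k ∧ k ≠ i ∧ swap i j * swap j k ∈ G

theorem swap_mul_swap_rotate (hab : a ≠ b) (hca : c ≠ a) :
    swap a b * swap b c = swap b c * swap c a := by
  rw [mul_swap_eq_swap_mul (swap b c), swap_apply_right,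
    swap_apply_of_ne_of_ne hab hca.symm, swap_comm a b]

theorem swap_mul_swap_mem_reverse (h : swap a b * swap b c ∈ G) :
    swap c b * swap b a ∈ G := by
  simpa [swap_comm] using G.inv_mem h

theorem swap_mul_swap_mem_conj {g : Perm ι} (hg : g ∈ G) (h : swap a b * swap b c ∈ G) :
    swap (g a) (g b) * swap (g b) (g c) ∈ G := by
  have := G.mul_mem (G.mul_mem hg h) (G.inv_mem hg)
  rw [swap_apply_apply, swap_apply_apply]
  simpa [mul_assoc] using this

/-- Conjugating a → b → c by a → d → c gives d → b → a, the inverse of the cycle sought. -/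
theorem swap_mul_swap_mem_of_common_pair (hab : a ≠ b) (hbc : b ≠ c) (hca : c ≠ a) (hda : d ≠ a)
    (hdb : d ≠ b) (h : swap a b * swap b c ∈ G) (h' : swap a d * swap d c ∈ G) :
    swap a b * swap b d ∈ G := by
  have := swap_mul_swap_mem_conj h' h
  simp only [Perm.mul_apply] at this
  rw [swap_apply_of_ne_of_ne hda.symm hca.symm, swap_apply_left,
    swap_apply_of_ne_of_ne hdb.symm hbc, swap_apply_of_ne_of_ne hab.symm hdb.symm,
    swap_apply_right, swap_apply_right, swap_mul_swap_rotate hdb hda.symm] at this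
  have := swap_mul_swap_mem_reverse this
  rwa [swap_mul_swap_rotate hda hdb.symm] at this

/-- With five distinct points, conjugating the first cycle by the second gives d → b → c;
conjugating the first cycle by the inverse of this one gives a → d → b. Coincidences among the
points are treated separately. -/
theorem swap_mul_swap_mem_of_common_point (hab : a ≠ b) (hbc : b ≠ c) (hca : c ≠ a) (hda : d ≠ a)
    (hdb : d ≠ b) (hde : d ≠ e) (hea : e ≠ a) (h : swap a b * swap b c ∈ G)
    (h' : swap a d * swap d e ∈ G) : swap a b * swap b d ∈ G := by
  rcases eq_or_ne d c with rfl | hdc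
  · exact h
  rcases eq_or_ne e b with rfl | heb
  · have := swap_mul_swap_mem_reverse h'
    rwa [swap_mul_swap_rotate hde.symm hab, swap_mul_swap_rotate hda hdb.symm] at this
  rcases eq_or_ne e c with rfl | hec
  · exact swap_mul_swap_mem_of_common_pair hab hbc hca hda hdb h h'
  have h1 := swap_mul_swap_mem_conj h' h
  simp only [Perm.mul_apply] at h1
  rw [swap_apply_of_ne_of_ne hda.symm hea.symm, swap_apply_left,
    swap_apply_of_ne_of_ne hdb.symm heb.symm, swap_apply_of_ne_of_ne hab.symm hdb.symm,
    swap_apply_of_ne_of_ne hdc.symm hec.symm, swap_apply_of_ne_of_ne hca hdc.symm] at h1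
  have h2 := swap_mul_swap_mem_conj (swap_mul_swap_mem_reverse h1) h
  simp only [Perm.mul_apply] at h2
  rw [swap_apply_of_ne_of_ne hab hda.symm, swap_apply_of_ne_of_ne hca.symm hab,
    swap_apply_left, swap_apply_of_ne_of_ne hdc hdb, swap_apply_of_ne_of_ne hbc.symm hdc.symm,
    swap_apply_left] at h2
  have h3 := swap_mul_swap_mem_reverse h2
  rwa [swap_mul_swap_rotate hdb.symm hab, swap_mul_swap_rotate hda hdb.symm] at h3

theorem Linked.symm (h : Linked G a b) : Linked G b a := by
  rcases h with rfl | ⟨c, hab, hbc, hca, h⟩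
  · exact .inl rfl
  · refine .inr ⟨c, hab.symm, hca.symm, hbc.symm, ?_⟩
    have := swap_mul_swap_mem_reverse h
    rwa [swap_mul_swap_rotate hbc.symm hca.symm] at this

theorem Linked.trans (h : Linked G a b) (h' : Linked G b c) : Linked G a c := by
  have h := h.symm
  rcases h with rfl | ⟨x, hab, hbx, hxa, h⟩
  · exact h'
  rcases h' with rfl | ⟨y, hbc, hcy, hya, h'⟩
  · exact .inr ⟨x, hab.symm, hxa.symm, hbx.symm, by
      have := swap_mul_swap_mem_reverse h
      rwa [swap_mul_swap_rotate hbx.symm hxa.symm] at this⟩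
  rcases eq_or_ne a c with rfl | hac
  · exact .inl rfl
  refine .inr ⟨b, hac, hbc.symm, hab, ?_⟩
  have := swap_mul_swap_mem_of_common_point hab hbx hxa hbc.symm hac.symm hcy hya h h'
  rwa [swap_mul_swap_rotate hab hbc.symm] at this

/-- The alternating group is generated by 3-cycles. For a 3-cycle through a, g a, g (g a), the links
from a to the two other points are 3-cycles with the common point a, and these produce it. -/
theorem alternatingGroup_le_of_forall_linked [Fintype ι] (h : ∀ i j, Linked G i j) :
    alternatingGroup ι ≤ G := by
  rw [← Perm.closure_three_cycles_eq_alternating, Subgroup.closure_le]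
  intro g hg
  have hg : g.IsThreeCycle := hg
  obtain ⟨a, ha⟩ := hg.isCycle.nonempty_support
  have hn := hg.nodup_iff_mem_support.mpr ha
  rw [SetLike.mem_coe, hg.eq_swap_mul_swap_iff_mem_support.mpr ha]
  simp only [List.nodup_cons, List.mem_cons, List.not_mem_nil, or_false, not_or] at hn
  obtain ⟨⟨hab, hac⟩, hbc, -⟩ := hn
  rcases h a (g a) with h1 | ⟨x, h1, h2, h3, hx⟩
  · exact absurd h1 hab
  rcases h a (g (g a)) with h4 | ⟨y, h4, h5, h6, hy⟩
  · exact absurd h4 hac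
  exact swap_mul_swap_mem_of_common_point h1 h2 h3 h4.symm (Ne.symm hbc) h5 h6 hx hy

end ThreeCycles

end Vacancy

namespace Vacancy

/-! ### The sign of an arrangement -/

section ArrangementSign

open Finset Equiv

variable {S : Type*} [Fintype S]

/-- The parity of the number of inversions of a function. -/
noncomputable def orderSign (k : S → ℤ) : ℤ :=
  ∏ j : Fin (Fintype.card S), ∏ i ∈ Iio j,
    (k ((Fintype.equivFin S).symm j) - k ((Fintype.equivFin S).symm i)).sign

/-- The parity of the number of inversions plus the sum of the values of a function. -/
noncomputable def arrangementSign (k : S → ℤ) : ℤ :=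
  orderSign k * ((∑ s, k s).negOnePow : ℤˣ)

variable {k k' : S → ℤ}

theorem orderSign_comp [DecidableEq S] (k : S → ℤ) (σ : Perm S) :
    orderSign (k ∘ σ) = Perm.sign σ * orderSign k := by
  have := ((Fintype.equivFin S).permCongr σ).prod_Iio_comp_eq_sign_mul_prod (R := ℤ)
    (f := fun i j => (k ((Fintype.equivFin S).symm j) - k ((Fintype.equivFin S).symm i)).sign)
    (fun i j => by rw [← Int.sign_neg, neg_sub])
  simpa [orderSign] using this

/-- Isolates the pairs containing `r`, the only ones affected when a key changes at a single site.
-/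
theorem prod_prod_Iio_of_eq_one {n : ℕ} (r : Fin n) (u : Fin n → ℤ) (g : Fin n → Fin n → ℤ)
    (hr : ∀ i, i ≠ r → g i r = u i) (hr' : ∀ i, i ≠ r → g r i = u i)
    (hg : ∀ i j, i ≠ r → j ≠ r → i ≠ j → g i j = 1) :
    ∏ j, ∏ i ∈ Iio j, g i j = ∏ i ∈ univ.filter (· ≠ r), u i := by
  have h1 : ∀ j, ∀ i ∈ Iio j, g i j = (if i = r then u j else 1) * if j = r then u i else 1 := by
    intro j i hi
    have hij := (mem_Iio.mp hi).ne
    rcases eq_or_ne i r with rfl | hi'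
    · simp [hij.symm, hr' j hij.symm]
    · rcases eq_or_ne j r with rfl | hj
      · simp [hij, hr i hij]
      · simp [hi', hj, hg i j hi' hj hij]
  have h2 : ∏ j, ∏ i ∈ Iio j, (if j = r then u i else 1) = ∏ i, if i < r then u i else 1 := by
    rw [prod_eq_single r (fun j _ hj => by simp [hj]) (by simp), prod_ite]
    simp [← prod_filter, filter_gt_eq_Iio]
  rw [prod_congr rfl fun j _ => prod_congr rfl (h1 j)]
  simp_rw [prod_mul_distrib]
  rw [h2, ← prod_mul_distrib, prod_filter]
  refine prod_congr rfl fun i _ => ?_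
  rcases lt_trichotomy i r with h | rfl | h
  · simp [h, h.ne, h.not_gt]
  · simp
  · simp [h, h.ne', h.not_gt]

theorem sign_mul_sign_self {a : ℤ} (ha : a ≠ 0) : a.sign * a.sign = 1 := by
  rcases ha.lt_or_gt with h | h
  · simp [Int.sign_eq_neg_one_of_neg h]
  · simp [Int.sign_eq_one_of_pos h]

theorem sign_mul_sign_eq_ite {a b : ℤ} (ha : a ≠ 0) (hb : b ≠ 0) :
    a.sign * b.sign = if (0 < b ↔ 0 < a) then 1 else -1 := by
  rcases ha.lt_or_gt with h | h <;> rcases hb.lt_or_gt with h' | h' <;>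
    simp [Int.sign_eq_neg_one_of_neg, Int.sign_eq_one_of_pos, h, h', h.not_gt, h'.not_gt]

theorem orderSign_mul_self (hk : Function.Injective k) : orderSign k * orderSign k = 1 := by
  rw [orderSign, ← prod_mul_distrib]
  refine prod_eq_one fun j _ => ?_
  rw [← prod_mul_distrib]
  refine prod_eq_one fun i hi => sign_mul_sign_self ?_
  rw [sub_ne_zero, hk.ne_iff, (Equiv.injective _).ne_iff]
  exact (mem_Iio.mp hi).ne'

theorem orderSign_eq_of_eqOn_compl [DecidableEq S] (hk : Function.Injective k)
    (hk' : Function.Injective k') (r : S) (h : ∀ s, s ≠ r → k' s = k s) :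
    orderSign k' =
      (-1) ^ #{s | s ≠ r ∧ ¬(k r < k s ↔ k' r < k s)} * orderSign k := by
  suffices orderSign k' * orderSign k = (-1) ^ #{s | s ≠ r ∧ ¬(k r < k s ↔ k' r < k s)} by
    rw [← this, mul_assoc, orderSign_mul_self hk, mul_one]
  set e := Fintype.equivFin S
  have hne {k : S → ℤ} (hk : Function.Injective k) {i j} (h : i ≠ j) :
      k (e.symm i) - k (e.symm j) ≠ 0 := by
    rwa [sub_ne_zero, hk.ne_iff, (Equiv.injective _).ne_iff]
  have hs {i : Fin (Fintype.card S)} (hi : i ≠ e r) : e.symm i ≠ r := by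
    rwa [Ne, symm_apply_eq]
  rw [orderSign, orderSign, ← prod_mul_distrib]
  simp_rw [← prod_mul_distrib]
  rw [prod_prod_Iio_of_eq_one (e r)
    fun i => if (k r < k (e.symm i) ↔ k' r < k (e.symm i)) then 1 else -1]
  · rw [← prod_equiv e (s := univ.filter (· ≠ r))
      (f := fun s => if (k r < k s ↔ k' r < k s) then 1 else -1) (by simp) (by simp),
      prod_ite, prod_const_one, prod_const, one_mul, filter_filter]
  · intro i hi
    rw [sign_mul_sign_eq_ite (hne hk' hi.symm) (hne hk hi.symm), symm_apply_apply, h _ (hs hi)]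
    have h1 := hne hk' hi.symm
    have h2 := hne hk hi.symm
    rw [symm_apply_apply, h _ (hs hi)] at h1
    rw [symm_apply_apply] at h2
    exact if_congr (by omega) rfl rfl
  · intro i hi
    rw [sign_mul_sign_eq_ite (hne hk' hi) (hne hk hi), symm_apply_apply, h _ (hs hi)]
    exact if_congr (by omega) rfl rfl
  · intro i j hi hj hij
    rw [h _ (hs hi), h _ (hs hj)]
    exact sign_mul_sign_self (hne hk hij.symm)

theorem arrangementSign_comp [DecidableEq S] (k : S → ℤ) (σ : Perm S) :
    arrangementSign (k ∘ σ) = Perm.sign σ * arrangementSign k := by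
  rw [arrangementSign, orderSign_comp, arrangementSign, mul_assoc]
  simp [σ.sum_comp]

theorem arrangementSign_ne_zero (hk : Function.Injective k) : arrangementSign k ≠ 0 :=
  mul_ne_zero (left_ne_zero_of_mul_eq_one (orderSign_mul_self hk)) (Units.ne_zero _)

/-- Each value overtaken by the changed one flips the inversion parity, and the displacement enters
through the sum. -/
theorem arrangementSign_eq_of_eqOn_compl [DecidableEq S] (hk : Function.Injective k) (hk' : Function.Injective k')
    (r : S) (h : ∀ s, s ≠ r → k' s = k s) (hodd : Odd
      ((#{s | s ≠ r ∧ ¬(k r < k s ↔ k' r < k s)} : ℤ) + (k' r - k r))) :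
    arrangementSign k' = -arrangementSign k := by
  have hsum : ∑ s, k' s = ∑ s, k s + (k' r - k r) := by
    rw [← add_sum_erase univ k' (mem_univ r), ← add_sum_erase univ k (mem_univ r),
      sum_congr rfl fun s hs => h s (ne_of_mem_erase hs)]
    ring
  have := congrArg Units.val (Int.negOnePow_odd _ hodd)
  rw [Int.negOnePow_add, Units.val_mul, Int.coe_negOnePow_natCast, Units.val_neg,
    Units.val_one] at this
  rw [arrangementSign, arrangementSign, orderSign_eq_of_eqOn_compl hk hk' r h, hsum,
    Int.negOnePow_add, Units.val_mul]
  linear_combination orderSign k * ((∑ s, k s).negOnePow : ℤˣ) * this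

end ArrangementSign

/-! ### The dynamics permutes the electrons evenly -/

section Parity

open Finset Equiv

variable {L N : ℕ}

/-- The number of the `α`-line through a site. -/
def lineIndex (L : ℕ) (α : Fin 3) (r : Site L) : ZMod L := ![r.2, r.1 - r.2, r.1] α

/-- The position of a site on its `α`-line. -/
def lineCoord (L : ℕ) (α : Fin 3) (r : Site L) : ZMod L := ![r.1, r.2, r.2] α

theorem lineIndex_add_e (α : Fin 3) (r : Site L) :
    lineIndex L α (r + e L α) = lineIndex L α r := by
  fin_cases α <;> simp [lineIndex, e]

theorem lineCoord_add_e (α : Fin 3) (r : Site L) :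
    lineCoord L α (r + e L α) = lineCoord L α r + 1 := by
  fin_cases α <;> simp [lineCoord, e]

theorem lineIndex_lineSite (α : Fin 3) (l t : ℕ) : lineIndex L α (lineSite L α l t) = l := by
  fin_cases α <;> simp [lineIndex, lineSite, e]

theorem lineCoord_lineSite (α : Fin 3) (l t : ℕ) : lineCoord L α (lineSite L α l t) = t := by
  fin_cases α <;> simp [lineCoord, lineSite, e]

theorem eq_of_lineIndex_eq {α : Fin 3} {r s : Site L} (h : lineIndex L α r = lineIndex L α s)
    (h' : lineCoord L α r = lineCoord L α s) : r = s := by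
  ext
  all_goals
    fin_cases α <;> simp_all [lineIndex, lineCoord]

theorem eq_of_intCast_zmod_eq {a b x : ℤ} (h : (a : ZMod L) = b) (ha : x < a) (ha' : a ≤ x + L)
    (hb : x < b) (hb' : b ≤ x + L) : a = b := by
  rw [ZMod.intCast_eq_intCast_iff_dvd_sub] at h
  have := Int.eq_zero_of_abs_lt_dvd h (abs_lt.mpr ⟨by omega, by omega⟩)
  omega

theorem exists_natCast_zmod_eq [NeZero L] (z : ZMod L) : ∃ t ∈ Icc 1 L, (t : ZMod L) = z := by
  have := z.val_lt
  rcases Nat.eq_zero_or_pos z.val with h | h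
  -- Lines and positions are numbered from 1 to L, so the residue 0 is represented by L.
  · exact ⟨L, by simp [NeZero.one_le], by rw [ZMod.natCast_self, (ZMod.val_eq_zero z).mp h]⟩
  · exact ⟨z.val, by simp; omega, by simp⟩

/-- The number of `α`-vacancies on an `α`-line. -/
def vacancyCount [NeZero L] (V : VacancyConfig L) (α : Fin 3) (ℓ : ZMod L) : ℕ :=
  #{s | V s = some α ∧ lineIndex L α s = ℓ}

theorem vacancyCount_eq_lineCount [NeZero L] (V : VacancyConfig L) (α : Fin 3) (l : ℕ) :
    vacancyCount V α l = lineCount V α l := by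
  symm
  refine card_bij (fun t _ => lineSite L α l t) (fun t ht => ?_) (fun t ht t' ht' h => ?_)
    (fun s hs => ?_)
  · simpa [lineIndex_lineSite] using (mem_filter.mp ht).2
  · have h := congrArg (lineCoord L α) h
    rw [lineCoord_lineSite, lineCoord_lineSite] at h
    have ht := mem_Icc.mp (mem_filter.mp ht).1
    have ht' := mem_Icc.mp (mem_filter.mp ht').1
    exact_mod_cast eq_of_intCast_zmod_eq (a := t) (b := t') (x := 0) (by exact_mod_cast h)
      (by omega) (by omega) (by omega) (by omega)
  · obtain ⟨t, ht, hts⟩ := exists_natCast_zmod_eq (lineCoord L α s)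
    have hs := (mem_filter.mp hs).2
    have hst : lineSite L α l t = s :=
      eq_of_lineIndex_eq (α := α) (by rw [lineIndex_lineSite, hs.2])
        (by rw [lineCoord_lineSite, hts])
    exact ⟨t, mem_filter.mpr ⟨ht, by rw [hst, hs.1]⟩, hst⟩

/-- The position of an `α`-vacancy in the order of the objects of a configuration. -/
def vacancyKey (N : ℕ) (α : Fin 3) (r : Site L) : ℕ :=
  N + ((α * L + (lineIndex L α r).val) * L + (lineCoord L α r).val)

open Classical in
/-- The order of the objects of a configuration: the electrons by their labels, then the vacancies
by their orientations, lines and positions. -/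
noncomputable def key (c : Config L N) (r : Site L) : ℤ :=
  match c.vac r with
  | some α => vacancyKey N α r
  -- The default 0 is never taken, since a site without a vacancy holds an electron.
  | none => if h : ∃ j, c.pos j = r then (h.choose : ℕ) else 0

theorem key_pos (c : Config L N) (j : Fin N) : key c (c.pos j) = j := by
  have h : ∃ i, c.pos i = c.pos j := ⟨j, rfl⟩
  rw [key, (c.vac_eq_none_iff _).mpr h]
  simp only [dif_pos h]
  rw [c.pos_injective h.choose_spec]

theorem key_eq_of_vac {c : Config L N} {r : Site L} {α : Fin 3} (h : c.vac r = some α) :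
    key c r = vacancyKey N α r := by
  simp [key, h]

theorem eq_key {c : Config L N} {k : Site L → ℤ} (h : ∀ j, k (c.pos j) = j)
    (h' : ∀ r α, c.vac r = some α → k r = vacancyKey N α r) : k = key c := by
  funext r
  rcases hr : c.vac r with _ | α
  · obtain ⟨j, rfl⟩ := (c.vac_eq_none_iff r).mp hr
    rw [h, key_pos]
  · rw [h' r α hr, key_eq_of_vac hr]

theorem mul_add_inj {a b s t n : ℕ} (hs : s < n) (ht : t < n) (h : a * n + s = b * n + t) :
    a = b ∧ s = t := by
  have h1 := congrArg (· / n) h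
  have h2 := congrArg (· % n) h
  have hn : 0 < n := by omega
  simp only [Nat.mul_add_mod_self_right, Nat.mod_eq_of_lt, hs, ht] at h2
  subst h2
  simpa [hn.ne'] using h

theorem vacancyKey_inj [NeZero L] {α β : Fin 3} {r s : Site L}
    (h : vacancyKey N α r = vacancyKey N β s) : α = β ∧ r = s := by
  obtain ⟨h1, h2⟩ := mul_add_inj (ZMod.val_lt _) (ZMod.val_lt _) (Nat.add_left_cancel h)
  obtain ⟨h3, h4⟩ := mul_add_inj (ZMod.val_lt _) (ZMod.val_lt _) h1
  obtain rfl := Fin.ext h3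
  exact ⟨rfl, eq_of_lineIndex_eq (ZMod.val_injective L h4) (ZMod.val_injective L h2)⟩

/-- The keys of one line fill a block of L consecutive integers, so only vacancies of that line can
be overtaken when a vacancy moves along it. -/
theorem vacancyKey_mem_line [NeZero L] {α β : Fin 3} {r s : Site L}
    (h : N + (α * L + (lineIndex L α r).val) * L ≤ vacancyKey N β s)
    (h' : vacancyKey N β s < N + (α * L + (lineIndex L α r).val) * L + L) :
    β = α ∧ lineIndex L α s = lineIndex L α r := by
  have hlt := (lineCoord L β s).val_lt
  rw [vacancyKey] at h h'
  have h1 : (β * L + (lineIndex L β s).val) = α * L + (lineIndex L α r).val := by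
    refine le_antisymm (Nat.lt_succ_iff.mp (lt_of_mul_lt_mul_right (a := L) ?_ (Nat.zero_le _)))
      (Nat.lt_succ_iff.mp (lt_of_mul_lt_mul_right (a := L) ?_ (Nat.zero_le _))) <;>
    · rw [Nat.succ_mul]
      omega
  obtain ⟨h3, h4⟩ := mul_add_inj (ZMod.val_lt _) (ZMod.val_lt _) h1
  obtain rfl := Fin.ext h3
  exact ⟨rfl, ZMod.val_injective L h4⟩

theorem key_injective [NeZero L] (c : Config L N) : Function.Injective (key c) := by
  intro r s h
  rcases hr : c.vac r with _ | α <;> rcases hs : c.vac s with _ | β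
  · obtain ⟨i, rfl⟩ := (c.vac_eq_none_iff r).mp hr
    obtain ⟨j, rfl⟩ := (c.vac_eq_none_iff s).mp hs
    rw [key_pos, key_pos] at h
    rw [Fin.ext (by exact_mod_cast h : (i : ℕ) = j)]
  · obtain ⟨i, rfl⟩ := (c.vac_eq_none_iff r).mp hr
    rw [key_pos, key_eq_of_vac hs, vacancyKey] at h
    omega
  · obtain ⟨j, rfl⟩ := (c.vac_eq_none_iff s).mp hs
    rw [key_pos, key_eq_of_vac hr, vacancyKey] at h
    omega
  · rw [key_eq_of_vac hr, key_eq_of_vac hs] at h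
    exact (vacancyKey_inj (by exact_mod_cast h)).2

/-- Relabelling electrons amounts to composing the key with a permutation of the sites: π⁻¹ carried
over to the occupied sites and extended by the identity. -/
theorem arrangementSign_key_permute [NeZero L] (c : Config L N) (π : Perm (Fin N)) :
    arrangementSign (key (c.permute π)) = Perm.sign π * arrangementSign (key c) := by
  classical
  let σ : Perm (Site L) := π⁻¹.extendDomain (Equiv.ofInjective c.pos c.pos_injective)
  have hσ (j : Fin N) : σ (c.pos j) = c.pos (π⁻¹ j) :=
    Perm.extendDomain_apply_image π⁻¹ (Equiv.ofInjective c.pos c.pos_injective) j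
  have : key c ∘ σ = key (c.permute π) := by
    refine eq_key (fun j => ?_) fun r α hr => ?_
    · simp [Config.permute, hσ, key_pos]
    · have hr' : r ∉ Set.range c.pos := fun h => by
        have := (c.vac_eq_none_iff r).mpr h
        exact absurd (this.symm.trans hr) (by simp)
      rw [Function.comp_apply, Perm.extendDomain_apply_not_subtype _ _ hr']
      exact key_eq_of_vac hr
  rw [← this, arrangementSign_comp, Perm.sign_extendDomain, Perm.sign_inv]

theorem add_e_ne {c : Config L N} {r : Site L} {α : Fin 3} {j : Fin N} (hj : c.pos j = r)
    (hα : c.vac (r + e L α) = some α) : r + e L α ≠ r := by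
  intro h
  rw [h, (c.vac_eq_none_iff r).mpr ⟨j, hj⟩] at hα
  simp at hα

theorem update_pos_eq {c : Config L N} {r : Site L} {α : Fin 3} {j : Fin N} (hj : c.pos j = r)
    (hα : c.vac (r + e L α) = some α) :
    Function.update c.pos j (r + e L α) = swap r (r + e L α) ∘ c.pos := by
  funext i
  rcases eq_or_ne i j with rfl | hij
  · simp [hj]
  · rw [Function.update_of_ne hij, Function.comp_apply, swap_apply_of_ne_of_ne]
    · rw [← hj]
      exact c.pos_injective.ne hij
    · intro h
      rw [← h, (c.vac_eq_none_iff _).mpr ⟨i, rfl⟩] at hα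
      simp at hα

theorem update_vac_eq {c : Config L N} {r : Site L} {α : Fin 3} {j : Fin N} (hj : c.pos j = r)
    (hα : c.vac (r + e L α) = some α) :
    Function.update (Function.update c.vac (r + e L α) none) r (some α) =
      c.vac ∘ swap r (r + e L α) := by
  funext s
  rcases eq_or_ne s r with rfl | hs
  · simp [hα]
  rcases eq_or_ne s (r + e L α) with rfl | hs'
  · simp [add_e_ne hj hα, (c.vac_eq_none_iff r).mpr ⟨j, hj⟩]
  · simp [hs, hs', swap_apply_of_ne_of_ne]

theorem Hop.vac_eq {c c' : Config L N} (h : Hop c c') : ∃ (r : Site L) (α : Fin 3) (j : Fin N),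
    c.pos j = r ∧ c.vac r = none ∧ c.vac (r + e L α) = some α ∧
      c'.pos = swap r (r + e L α) ∘ c.pos ∧ c'.vac = c.vac ∘ swap r (r + e L α) := by
  obtain ⟨r, α, j, hj, hα, hp, hv⟩ := h
  exact ⟨r, α, j, hj, (c.vac_eq_none_iff r).mpr ⟨j, hj⟩, hα, hp.trans (update_pos_eq hj hα),
    hv.trans (update_vac_eq hj hα)⟩

theorem Hop.vacancyCount_eq [NeZero L] {c c' : Config L N} (h : Hop c c') (β : Fin 3) (ℓ : ZMod L) :
    vacancyCount c'.vac β ℓ = vacancyCount c.vac β ℓ := by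
  obtain ⟨r, α, -, -, hr, hα, -, hv⟩ := h.vac_eq
  refine card_equiv (swap r (r + e L α)) fun s => ?_
  rw [mem_filter_univ, mem_filter_univ, hv, Function.comp_apply]
  refine and_congr_right fun hs => ?_
  suffices lineIndex L β (swap r (r + e L α) s) = lineIndex L β s by rw [this]
  rcases eq_or_ne s r with rfl | hsr
  · rw [swap_apply_left] at hs ⊢
    obtain rfl : α = β := by simpa [hα] using hs
    exact lineIndex_add_e α s
  rcases eq_or_ne s (r + e L α) with rfl | hsr'
  · simp [hr] at hs
  · rw [swap_apply_of_ne_of_ne hsr hsr']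

theorem Hop.arrangementSign_eq [NeZero L] (hL : 1 < L) {m : Fin 3 → ℕ} {c c' : Config L N}
    (h : Hop c c') (hodd : ∀ α, m α ≠ 0 → Odd ((L : ℤ) - m α))
    (hc : ∀ α ℓ, vacancyCount c.vac α ℓ = m α) :
    arrangementSign (key c') = arrangementSign (key c) := by
  obtain ⟨r, α, j, hj, hr, hα, hp, hv⟩ := h.vac_eq
  have hre : r ≠ r + e L α := (add_e_ne hj hα).symm
  have hposre (i : Fin N) : c.pos i ≠ r + e L α := by
    intro h
    rw [← h, (c.vac_eq_none_iff _).mpr ⟨i, rfl⟩] at hα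
    simp at hα
  -- The hop is split into a transposition of the two sites, which carries the old vacancy key to
  -- `r`, and a correction of that key.
  have hkey : Function.update (key c ∘ swap r (r + e L α)) r (vacancyKey N α r) = key c' := by
    refine eq_key (fun i => ?_) fun s β hs => ?_
    · have hne : swap r (r + e L α) (c.pos i) ≠ r := by
        rw [Ne, swap_apply_eq_iff, swap_apply_left]
        exact hposre i
      rw [hp, Function.comp_apply, Function.update_of_ne hne, Function.comp_apply, swap_apply_self,
        key_pos]
    · rw [hv, Function.comp_apply] at hs
      rcases eq_or_ne s r with rfl | hsr
      · rw [swap_apply_left, hα, Option.some.injEq] at hs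
        simp [hs]
      · have hsr' : s ≠ r + e L α := by
          rintro rfl
          rw [swap_apply_right, hr] at hs
          simp at hs
        rw [swap_apply_of_ne_of_ne hsr hsr'] at hs
        rw [Function.update_of_ne hsr, Function.comp_apply, swap_apply_of_ne_of_ne hsr hsr',
          key_eq_of_vac hs]
  have hinj : Function.Injective (key c ∘ swap r (r + e L α)) :=
    (key_injective c).comp (Equiv.injective _)
  suffices hodd' : Odd ((#{s | s ≠ r ∧ ¬((key c ∘ swap r (r + e L α)) r <
      (key c ∘ swap r (r + e L α)) s ↔ key c' r < (key c ∘ swap r (r + e L α)) s)} : ℤ) +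
      (key c' r - (key c ∘ swap r (r + e L α)) r)) by
    rw [arrangementSign_eq_of_eqOn_compl hinj (key_injective c') r
      (fun s hs => by rw [← hkey, Function.update_of_ne hs]) hodd', arrangementSign_comp,
      Perm.sign_swap hre]
    simp
  have hB : key c' r = ((N + (α * L + (lineIndex L α r).val) * L : ℕ) : ℤ) +
      (lineCoord L α r).val := by
    rw [← hkey, Function.update_self, vacancyKey, ← Nat.cast_add, add_assoc]
  have hB' : (key c ∘ swap r (r + e L α)) r = ((N + (α * L + (lineIndex L α r).val) * L : ℕ) : ℤ) +
      (lineCoord L α r + 1).val := by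
    rw [Function.comp_apply, swap_apply_left, key_eq_of_vac hα, vacancyKey, ← Nat.cast_add,
      lineIndex_add_e, lineCoord_add_e, add_assoc]
  have hlt := (lineCoord L α r).val_lt
  have hval : (lineCoord L α r + 1).val =
      if (lineCoord L α r).val + 1 = L then 0 else (lineCoord L α r).val + 1 := by
    have : Fact (1 < L) := ⟨hL⟩
    rw [ZMod.val_add, ZMod.val_one]
    split_ifs with h
    · rw [h, Nat.mod_self]
    · exact Nat.mod_eq_of_lt (by omega)
  -- Without wrapping, the old and new keys are consecutive and nothing lies between them. With
  -- wrapping, exactly the other vacancies of the line do.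
  have hbetween (s : Site L) (hs : s ≠ r) :
      ¬((key c ∘ swap r (r + e L α)) r < (key c ∘ swap r (r + e L α)) s ↔
        key c' r < (key c ∘ swap r (r + e L α)) s) ↔ (lineCoord L α r).val + 1 = L ∧
        s ≠ r + e L α ∧ c.vac s = some α ∧ lineIndex L α s = lineIndex L α r := by
    rcases eq_or_ne s (r + e L α) with rfl | hs'
    · rw [hB, hB']
      have : (key c ∘ swap r (r + e L α)) (r + e L α) = j := by
        rw [Function.comp_apply, swap_apply_right, ← hj, key_pos]
      rw [this]
      simp only [ne_eq, not_true_eq_false, false_and, and_false, iff_false, not_not]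
      have := j.isLt
      omega
    have hks : (key c ∘ swap r (r + e L α)) s = key c s := by
      rw [Function.comp_apply, swap_apply_of_ne_of_ne hs hs']
    have hne : (key c ∘ swap r (r + e L α)) s ≠ (key c ∘ swap r (r + e L α)) r := hinj.ne hs
    rw [hB, hB', hval]
    rw [hB', hval] at hne
    rw [hks] at hne ⊢
    rcases hvs : c.vac s with _ | β
    · obtain ⟨i, rfl⟩ := (c.vac_eq_none_iff s).mp hvs
      rw [key_pos]
      have := i.isLt
      simp only [reduceCtorEq, false_and, and_false, iff_false, not_not]
      omega
    rw [key_eq_of_vac hvs] at hne ⊢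
    constructor
    · intro h
      split_ifs at h hne with hw
      · obtain ⟨rfl, h2⟩ := vacancyKey_mem_line (α := α) (β := β) (N := N) (r := r) (s := s)
          (by omega) (by omega)
        exact ⟨hw, hs', rfl, h2⟩
      · omega
    · rintro ⟨hw, -, hβ, hl⟩
      obtain rfl : β = α := by simpa using hβ
      have h1 : (lineCoord L β s).val ≠ (lineCoord L β r).val := fun h =>
        hs (eq_of_lineIndex_eq hl (ZMod.val_injective L h))
      have h2 : (lineCoord L β s).val ≠ (lineCoord L β r + 1).val := fun h =>
        hs' (eq_of_lineIndex_eq (α := β) (by rw [hl, lineIndex_add_e])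
          (by rw [ZMod.val_injective L h, lineCoord_add_e]))
      have h3 := (lineCoord L β s).val_lt
      rw [hval, if_pos hw] at h2
      rw [if_pos hw, vacancyKey, hl]
      omega
  rw [filter_congr fun s _ => and_congr_right (hbetween s), hB, hB', hval]
  split_ifs with hw
  · have : (univ.filter fun s => s ≠ r ∧ (lineCoord L α r).val + 1 = L ∧
        s ≠ r + e L α ∧ c.vac s = some α ∧ lineIndex L α s = lineIndex L α r) =
        (univ.filter fun s => c.vac s = some α ∧ lineIndex L α s = lineIndex L α r).erase
          (r + e L α) := by
      ext s
      rw [mem_erase, mem_filter_univ, mem_filter_univ]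
      refine ⟨fun h => h.2.2, fun h => ⟨?_, hw, h⟩⟩
      rintro rfl
      simp [hr] at h
    have hmem : r + e L α ∈
        univ.filter fun s => c.vac s = some α ∧ lineIndex L α s = lineIndex L α r := by
      simp [hα, lineIndex_add_e]
    have hcard := card_erase_add_one hmem
    have hm := hc α (lineIndex L α r)
    rw [vacancyCount] at hm
    rw [this]
    -- The m_α - 1 vacancies overtaken and the displacement L - 1 add up to the parity of L - m_α.
    obtain ⟨q, hq⟩ := hodd α (by omega)
    exact ⟨q + m α - 1, by omega⟩
  · simp [hw]

theorem Connected.arrangementSign_eq [NeZero L] (hL : 1 < L) {m : Fin 3 → ℕ} {c c' : Config L N}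
    (h : Connected c c') (hodd : ∀ α, m α ≠ 0 → Odd ((L : ℤ) - m α))
    (hc : ∀ α ℓ, vacancyCount c.vac α ℓ = m α) :
    arrangementSign (key c') = arrangementSign (key c) ∧
      ∀ α ℓ, vacancyCount c'.vac α ℓ = m α := by
  induction h with
  | refl => exact ⟨rfl, hc⟩
  | tail _ hs ih =>
    rcases hs with hs | hs
    · exact ⟨(hs.arrangementSign_eq hL hodd ih.2).trans ih.1,
        fun α ℓ => (hs.vacancyCount_eq α ℓ).trans (ih.2 α ℓ)⟩
    · have hc' : ∀ α ℓ, vacancyCount _ α ℓ = m α :=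
        fun α ℓ => (hs.vacancyCount_eq α ℓ).symm.trans (ih.2 α ℓ)
      exact ⟨(hs.arrangementSign_eq hL hodd hc').symm.trans ih.1, hc'⟩

theorem mem_alternatingGroup_of_connected_permute [NeZero L] (hL : 1 < L) {m : Fin 3 → ℕ}
    {c : Config L N} {π : Perm (Fin N)} (h : Connected c (c.permute π))
    (hodd : ∀ α, m α ≠ 0 → Odd ((L : ℤ) - m α))
    (hc : ∀ α, ∀ l ∈ Icc 1 L, lineCount c.vac α l = m α) : π ∈ alternatingGroup (Fin N) := by
  have hc' : ∀ α ℓ, vacancyCount c.vac α ℓ = m α := by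
    intro α ℓ
    obtain ⟨l, hl, rfl⟩ := exists_natCast_zmod_eq ℓ
    rw [vacancyCount_eq_lineCount, hc α l hl]
  have := (h.arrangementSign_eq hL hodd hc').1
  rw [arrangementSign_key_permute,
    mul_eq_right₀ (arrangementSign_ne_zero (key_injective c))] at this
  rw [Perm.mem_alternatingGroup]
  exact Units.ext this

end Parity

end Vacancy

namespace Vacancy

/-! ### Vacancies on a planar board -/

section Board

open Equiv Relation

variable {N : ℕ}

/-- A planar board; `inl α` is an `α`-vacancy and `inr j` is the `j`-th electron. -/
abbrev Board (N : ℕ) : Type := ℤ × ℤ → Fin 3 ⊕ Fin N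

/-- The directions in which `α`-vacancies move on a board: horizontally for the first orientation,
vertically for the third one. -/
def IsMove (α : Fin 3) (d : ℤ × ℤ) : Prop :=
  (α = 0 ∧ (d = (1, 0) ∨ d = (-1, 0))) ∨ (α = 2 ∧ (d = (0, 1) ∨ d = (0, -1)))

/-- Exchange of a vacancy with a neighbouring electron. -/
def BoardStep (f f' : Board N) : Prop :=
  ∃ (a d : ℤ × ℤ) (α : Fin 3) (j : Fin N),
    IsMove α d ∧ f a = .inl α ∧ f (a + d) = .inr j ∧ f' = f ∘ swap a (a + d)

/-- Reachability by exchanges of vacancies and electrons. -/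
def BoardReach : Board N → Board N → Prop := ReflTransGen BoardStep

/-- No electron occurs twice on the board. -/
def ElectronInjective (f : Board N) : Prop :=
  ∀ a b j, f a = .inr j → f b = .inr j → a = b

/-- The board with permuted electron labels. -/
def relabel (π : Perm (Fin N)) (f : Board N) : Board N := Sum.map id π ∘ f

variable {f f' f'' : Board N} {α : Fin 3} {d : ℤ × ℤ} {π : Perm (Fin N)}

theorem IsMove.neg (h : IsMove α d) : IsMove α (-d) := by
  rcases h with ⟨rfl, rfl | rfl⟩ | ⟨rfl, rfl | rfl⟩ <;> simp [IsMove]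

theorem IsMove.ne_zero (h : IsMove α d) : d ≠ 0 := by
  rcases h with ⟨rfl, rfl | rfl⟩ | ⟨rfl, rfl | rfl⟩ <;> simp

theorem IsMove.add_smul_inj (h : IsMove α d) (q : ℤ × ℤ) {s t : ℤ} :
    q + s • d = q + t • d ↔ s = t := by
  rw [add_right_inj]
  rcases h with ⟨rfl, rfl | rfl⟩ | ⟨rfl, rfl | rfl⟩ <;> simp

theorem BoardStep.symm (h : BoardStep f f') : BoardStep f' f := by
  obtain ⟨a, d, α, j, hd, h1, h2, rfl⟩ := h
  refine ⟨a + d, -d, α, j, hd.neg, by simpa using h1, by simpa using h2, ?_⟩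
  funext x
  simp [swap_comm (a + d) a]

theorem BoardReach.symm (h : BoardReach f f') : BoardReach f' f := by
  induction h with
  | refl => exact ReflTransGen.refl
  | tail _ hs ih => exact ReflTransGen.head hs.symm ih

theorem BoardReach.trans (h : BoardReach f f') (h' : BoardReach f' f'') : BoardReach f f'' :=
  ReflTransGen.trans h h'

theorem ElectronInjective.comp (h : ElectronInjective f) (σ : Perm (ℤ × ℤ)) :
    ElectronInjective (f ∘ σ) :=
  fun _ _ j ha hb => σ.injective (h _ _ j ha hb)

theorem ElectronInjective.of_reach (h : ElectronInjective f) (hr : BoardReach f f') :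
    ElectronInjective f' := by
  induction hr with
  | refl => exact h
  | tail _ hs ih =>
    obtain ⟨a, d, α, j, -, -, -, rfl⟩ := hs
    exact ih.comp _

theorem relabel_mul (π ρ : Perm (Fin N)) (f : Board N) :
    relabel (π * ρ) f = relabel π (relabel ρ f) := by
  funext x
  simp only [relabel, Function.comp_apply]
  rcases f x with α | j <;> simp

theorem relabel_one (f : Board N) : relabel 1 f = f := by
  funext x
  simp only [relabel, Function.comp_apply]
  rcases f x with α | j <;> simp

theorem BoardStep.relabel (h : BoardStep f f') (π : Perm (Fin N)) :
    BoardStep (relabel π f) (relabel π f') := by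
  obtain ⟨a, d, α, j, hd, h1, h2, rfl⟩ := h
  exact ⟨a, d, α, π j, hd, by simp [Vacancy.relabel, h1], by simp [Vacancy.relabel, h2], rfl⟩

theorem BoardReach.relabel (h : BoardReach f f') (π : Perm (Fin N)) :
    BoardReach (relabel π f) (relabel π f') := by
  induction h with
  | refl => exact ReflTransGen.refl
  | tail _ hs ih => exact ReflTransGen.tail ih (BoardStep.relabel hs π)

/-- The permutations of the electrons that the dynamics on the board induces. -/
def labelGroup (f : Board N) : Subgroup (Perm (Fin N)) where
  carrier := {π | BoardReach f (relabel π f)}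
  mul_mem' {π ρ} hπ hρ := by
    rw [Set.mem_ofPred_eq, relabel_mul]
    exact BoardReach.trans hπ (BoardReach.relabel hρ π)
  one_mem' := by
    rw [Set.mem_ofPred_eq, relabel_one]
    exact ReflTransGen.refl
  inv_mem' {π} hπ := by
    have := BoardReach.relabel hπ π⁻¹
    rw [← relabel_mul, inv_mul_cancel, relabel_one] at this
    exact this.symm

theorem mem_labelGroup : π ∈ labelGroup f ↔ BoardReach f (relabel π f) := Iff.rfl

/-- Relabelling commutes with moves, so a path from `f` to `f'` can be traversed, and retraced after
relabelling, without changing the permutation. Preparatory moves are therefore free. -/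
theorem labelGroup_eq (h : BoardReach f f') : labelGroup f = labelGroup f' := by
  ext π
  exact ⟨fun hπ => (h.symm.trans hπ).trans (h.relabel π),
    fun hπ => (h.trans hπ).trans (h.relabel π).symm⟩

/-- Both contents are electrons, and the electrons are linked by the group. -/
def ContentLinked (G : Subgroup (Perm (Fin N))) (u v : Fin 3 ⊕ Fin N) : Prop :=
  ∃ i j, u = .inr i ∧ v = .inr j ∧ Linked G i j

theorem ContentLinked.symm {G : Subgroup (Perm (Fin N))} {u v : Fin 3 ⊕ Fin N}
    (h : ContentLinked G u v) : ContentLinked G v u := by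
  obtain ⟨i, j, hi, hj, h⟩ := h
  exact ⟨j, i, hj, hi, h.symm⟩

theorem ContentLinked.trans {G : Subgroup (Perm (Fin N))} {u v w : Fin 3 ⊕ Fin N}
    (h : ContentLinked G u v) (h' : ContentLinked G v w) : ContentLinked G u w := by
  obtain ⟨i, j, hi, hj, h⟩ := h
  obtain ⟨j', k, hj', hk, h'⟩ := h'
  rw [hj, Sum.inr.injEq] at hj'
  subst hj'
  exact ⟨i, k, hi, hk, h.trans h'⟩

theorem comp_swap_eq_relabel (hf : ElectronInjective f) {p q : ℤ × ℤ} {i j : Fin N}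
    (hp : f p = .inr i) (hq : f q = .inr j) : f ∘ swap p q = relabel (swap i j) f := by
  funext x
  simp only [relabel, Function.comp_apply]
  rcases eq_or_ne x p with rfl | hxp
  · simp [hp, hq]
  rcases eq_or_ne x q with rfl | hxq
  · simp [hp, hq]
  rw [swap_apply_of_ne_of_ne hxp hxq]
  rcases hx : f x with α | k
  · simp
  · rw [Sum.map_inr, swap_apply_of_ne_of_ne]
    · rintro rfl
      exact hxp (hf _ _ _ hx hp)
    · rintro rfl
      exact hxq (hf _ _ _ hx hq)

/-- A vacancy moves past `n` electrons in a row. -/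
theorem exists_pull (hd : IsMove α d) (n : ℕ) (q : ℤ × ℤ) (h0 : f q = .inl α)
    (h : ∀ t : ℤ, 1 ≤ t → t ≤ n → ∃ j, f (q + t • d) = .inr j) :
    ∃ f', BoardReach f f' ∧ (∀ t : ℤ, 0 ≤ t → t < n → f' (q + t • d) = f (q + (t + 1) • d)) ∧
      f' (q + (n : ℤ) • d) = .inl α ∧
      ∀ r, (∀ t : ℤ, 0 ≤ t → t ≤ n → r ≠ q + t • d) → f' r = f r := by
  induction n with
  | zero => exact ⟨f, ReflTransGen.refl, fun t h1 h2 => by simp at h2; omega, by simpa using h0,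
      fun _ _ => rfl⟩
  | succ n ih =>
    push_cast at h ⊢
    obtain ⟨g, hg, h1, h2, h3⟩ := ih fun t ht ht' => h t ht (by omega)
    obtain ⟨j, hj⟩ := h (n + 1) (by omega) (by omega)
    have hlast : g (q + ((n : ℤ) + 1) • d) = f (q + ((n : ℤ) + 1) • d) := by
      refine h3 _ fun t ht ht' => ?_
      rw [Ne, hd.add_smul_inj]
      omega
    have hadd : q + (n : ℤ) • d + d = q + ((n : ℤ) + 1) • d := by
      rw [add_smul, one_smul, add_assoc]
    refine ⟨g ∘ swap (q + (n : ℤ) • d) (q + ((n : ℤ) + 1) • d), hg.tail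
      ⟨q + (n : ℤ) • d, d, α, j, hd, h2, ?_, ?_⟩, ?_, ?_, ?_⟩
    · rw [hadd, hlast, hj]
    · rw [hadd]
    · intro t ht ht'
      rcases eq_or_ne t n with rfl | htn
      · rw [Function.comp_apply, swap_apply_left, hlast]
      · rw [Function.comp_apply, swap_apply_of_ne_of_ne, h1 t ht (by omega)]
        · rwa [Ne, hd.add_smul_inj]
        · rw [Ne, hd.add_smul_inj]
          omega
    · simpa using h2
    · intro r hr
      rw [Function.comp_apply, swap_apply_of_ne_of_ne (hr _ (by omega) (by omega))
        (hr _ (by omega) (by omega))]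
      exact h3 r fun t ht ht' => hr t ht (by omega)

/-- A train of `s` vacancies moves past `n` electrons in a row. -/
theorem exists_pull_train (hd : IsMove α d) (s n : ℕ) (q : ℤ × ℤ)
    (h0 : ∀ t : ℤ, -(s : ℤ) < t → t ≤ 0 → f (q + t • d) = .inl α)
    (h : ∀ t : ℤ, 1 ≤ t → t ≤ n → ∃ j, f (q + t • d) = .inr j) :
    ∃ f', BoardReach f f' ∧
      (∀ t : ℤ, 1 ≤ t → t ≤ n → f' (q + (t - s) • d) = f (q + t • d)) ∧
      (∀ t : ℤ, n - s < t → t ≤ n → f' (q + t • d) = .inl α) ∧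
      ∀ r, (∀ t : ℤ, -(s : ℤ) < t → t ≤ n → r ≠ q + t • d) → f' r = f r := by
  induction s generalizing f q with
  | zero => exact ⟨f, ReflTransGen.refl, by simp, fun t _ _ => by push_cast at *; omega,
      fun _ _ => rfl⟩
  | succ s ih =>
    push_cast at h0 h ⊢
    have hsub (t : ℤ) : q - d + t • d = q + (t - 1) • d := by
      rw [sub_smul, one_smul]
      abel
    -- The front vacancy goes first; the rest of the train, with its head at `q - d`, then faces the
    -- same electrons shifted back by one site.
    obtain ⟨g, hg, h1, h2, h3⟩ := exists_pull hd n q (by simpa using h0 0 (by omega) le_rfl) h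
    have hvac : ∀ t : ℤ, -(s : ℤ) < t → t ≤ 0 → g (q - d + t • d) = .inl α := by
      intro t ht ht'
      rw [hsub, h3]
      · exact h0 _ (by omega) (by omega)
      · intro t' ht' ht''
        rw [Ne, hd.add_smul_inj]
        omega
    have hel : ∀ t : ℤ, 1 ≤ t → t ≤ n → ∃ j, g (q - d + t • d) = .inr j := by
      intro t ht ht'
      rw [hsub, h1 _ (by omega) (by omega), sub_add_cancel]
      exact h t ht ht'
    obtain ⟨g', hg', h1', h2', h3'⟩ := ih (f := g) (q - d) hvac hel
    refine ⟨g', hg.trans hg', ?_, ?_, ?_⟩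
    · intro t ht ht'
      have := h1' t ht ht'
      rw [hsub, hsub, h1 (t - 1) (by omega) (by omega)] at this
      simpa [sub_sub] using this
    · intro t ht ht'
      rcases eq_or_ne t n with rfl | htn
      · rw [h3', h2]
        intro t ht ht'
        rw [hsub, Ne, hd.add_smul_inj]
        omega
      · have := h2' (t + 1) (by omega) (by omega)
        rwa [hsub, add_sub_cancel_right] at this
    · intro r hr
      rw [h3', h3]
      · exact fun t ht ht' => hr t (by omega) ht'
      · intro t ht ht'
        rw [hsub]
        exact hr _ (by omega) (by omega)

end Board

end Vacancy

namespace Vacancy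

/-! ### Three-cycles from two crossing vacancies -/

section Crossing

open Equiv Relation

variable {N : ℕ} {f f' : Board N}

theorem exists_pull_row (x x' y s : ℤ) (hs : 0 ≤ s) (hx : x ≤ x')
    (hv : ∀ X, x - s < X → X ≤ x → f (X, y) = .inl 0)
    (he : ∀ X, x < X → X ≤ x' → ∃ j, f (X, y) = .inr j) :
    ∃ f', BoardReach f f' ∧ (∀ X, x < X → X ≤ x' → f' (X - s, y) = f (X, y)) ∧
      ∀ X Y, (Y ≠ y ∨ X ≤ x - s ∨ x' < X) → f' (X, Y) = f (X, Y) := by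
  lift s to ℕ using hs
  obtain ⟨n, rfl⟩ := Int.le.dest hx
  have hd : IsMove 0 (1, 0) := .inl ⟨rfl, .inl rfl⟩
  have hq (t : ℤ) : (x, y) + t • ((1, 0) : ℤ × ℤ) = (x + t, y) := by simp
  obtain ⟨f', hf', h1, -, h3⟩ := exists_pull_train (f := f) hd s n (x, y)
    (fun t ht ht' => by rw [hq]; exact hv _ (by omega) (by omega))
    (fun t ht ht' => by rw [hq]; exact he _ (by omega) (by omega))
  refine ⟨f', hf', fun X hX hX' => ?_, fun X Y hXY => h3 _ fun t ht ht' => ?_⟩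
  · have := h1 (X - x) (by omega) (by omega)
    rwa [hq, hq, show x + (X - x - s) = X - s by ring, add_sub_cancel] at this
  · rw [hq, Ne, Prod.mk.injEq]
    omega

theorem exists_pull_column (x y y' s : ℤ) (hs : 0 ≤ s) (hy : y ≤ y')
    (hv : ∀ Y, y - s < Y → Y ≤ y → f (x, Y) = .inl 2)
    (he : ∀ Y, y < Y → Y ≤ y' → ∃ j, f (x, Y) = .inr j) :
    ∃ f', BoardReach f f' ∧ (∀ Y, y < Y → Y ≤ y' → f' (x, Y - s) = f (x, Y)) ∧
      (∀ Y, y' - s < Y → Y ≤ y' → f' (x, Y) = .inl 2) ∧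
      ∀ X Y, (X ≠ x ∨ Y ≤ y - s ∨ y' < Y) → f' (X, Y) = f (X, Y) := by
  lift s to ℕ using hs
  obtain ⟨n, rfl⟩ := Int.le.dest hy
  have hd : IsMove 2 (0, 1) := .inr ⟨rfl, .inl rfl⟩
  have hq (t : ℤ) : (x, y) + t • ((0, 1) : ℤ × ℤ) = (x, y + t) := by simp
  obtain ⟨f', hf', h1, h2, h3⟩ := exists_pull_train (f := f) hd s n (x, y)
    (fun t ht ht' => by rw [hq]; exact hv _ (by omega) (by omega))
    (fun t ht ht' => by rw [hq]; exact he _ (by omega) (by omega))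
  refine ⟨f', hf', fun Y hY hY' => ?_, fun Y hY hY' => ?_, fun X Y hXY => h3 _ fun t ht ht' => ?_⟩
  · have := h1 (Y - y) (by omega) (by omega)
    rwa [hq, hq, show y + (Y - y - s) = Y - s by ring, add_sub_cancel] at this
  · have := h2 (Y - y) (by omega) (by omega)
    rwa [hq, add_sub_cancel] at this
  · rw [hq, Ne, Prod.mk.injEq]
    omega

/-- The left side is the commutator of the 3-cycles on u, p, r and on v, p, w, which share only p.
-/
theorem commutator_swaps {X : Type*} [DecidableEq X] {u v p r w : X} (h : [u, v, p, r, w].Nodup) :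
    swap u p * swap p r * (swap v p * swap p w) * (swap p r * swap u p) * (swap p w * swap v p) =
      swap p r * swap r w := by
  simp only [List.nodup_cons, List.mem_cons, List.not_mem_nil, or_false, not_or] at h
  obtain ⟨⟨h1, h2, h3, h4⟩, ⟨h5, h6, h7⟩, ⟨h8, h9⟩, h10, -⟩ := h
  ext z
  simp only [Perm.mul_apply]
  by_cases hu : z = u
  · subst hu
    simp [swap_apply_of_ne_of_ne, *, Ne.symm]
  by_cases hv : z = v
  · subst hv
    simp [swap_apply_of_ne_of_ne, *, Ne.symm]
  by_cases hp : z = p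
  · subst hp
    simp [swap_apply_of_ne_of_ne, *, Ne.symm]
  by_cases hr : z = r
  · subst hr
    simp [swap_apply_of_ne_of_ne, *, Ne.symm]
  by_cases hw : z = w
  · subst hw
    simp [swap_apply_of_ne_of_ne, *, Ne.symm]
  simp [swap_apply_of_ne_of_ne, *]

theorem BoardReach.pass {α : Fin 3} {d : ℤ × ℤ} (hd : IsMove α d) {u p r : ℤ × ℤ} (hup : p = u + d)
    (hpr : r = p + d) (hu : f u = .inl α) {i j : Fin N} (hp : f p = .inr i) (hr : f r = .inr j) :
    BoardReach f (f ∘ ⇑(swap u p * swap p r)) := by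
  have hrp : r ≠ p := by rw [hpr]; simpa using hd.ne_zero
  have hru : r ≠ u := by
    have := (hd.add_smul_inj u (s := 2) (t := 0)).not.mpr (by norm_num)
    rw [hpr, hup]
    simpa [two_smul, add_assoc] using this
  refine (ReflTransGen.single ⟨u, d, α, i, hd, hu, hup ▸ hp, rfl⟩).tail
    ⟨p, d, α, j, hd, ?_, ?_, ?_⟩
  · simp [← hup, hu]
  · rw [← hup, ← hpr, Function.comp_apply, swap_apply_of_ne_of_ne hru hrp, hr]
  · rw [← hup, ← hpr]
    rfl

/-- The first vacancy runs from u through p to r, the second from v through p to w, then the first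
returns and the second returns. All vacancies are back in place, and the electrons at p, r, w have
been cycled. -/
theorem mem_labelGroup_of_adjacent_vacancies (hf : ElectronInjective f) {α β : Fin 3}
    {d d' u v p r w : ℤ × ℤ} (hd : IsMove α d) (hd' : IsMove β d')
    (h : [u, v, p, r, w].Nodup) (hup : p = u + d) (hpr : r = p + d) (hvp : p = v + d')
    (hpw : w = p + d') {i j k : Fin N} (hu : f u = .inl α) (hv : f v = .inl β)
    (hp : f p = .inr i) (hr : f r = .inr j) (hw : f w = .inr k) :
    swap i j * swap j k ∈ labelGroup f := by
  have hc := commutator_swaps h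
  simp only [List.nodup_cons, List.mem_cons, List.not_mem_nil, or_false, not_or] at h
  obtain ⟨⟨h1, h2, h3, h4⟩, ⟨h5, h6, h7⟩, ⟨h8, h9⟩, h10, -⟩ := h
  have hrel : relabel (swap i j * swap j k) f = f ∘ ⇑(swap p r * swap r w) := by
    rw [relabel_mul, ← comp_swap_eq_relabel hf hr hw, Perm.coe_mul, ← Function.comp_assoc,
      comp_swap_eq_relabel hf hp hr]
    rfl
  rw [mem_labelGroup, hrel, ← hc]
  have r1 := BoardReach.pass hd hup hpr hu hp hr
  have r2 := BoardReach.pass (f := f ∘ ⇑(swap u p * swap p r)) hd' (i := j) (j := k) hvp hpw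
    (by simp [swap_apply_of_ne_of_ne, Ne.symm, *, -hup, -hpr, -hvp, -hpw])
    (by simp [swap_apply_of_ne_of_ne, Ne.symm, *, -hup, -hpr, -hvp, -hpw])
    (by simp [swap_apply_of_ne_of_ne, Ne.symm, *, -hup, -hpr, -hvp, -hpw])
  have r3 := BoardReach.pass (u := r) (p := p) (r := u) hd.neg (by rw [hpr]; simp)
    (by rw [hup]; simp) (i := k) (j := i)
    (f := (f ∘ ⇑(swap u p * swap p r)) ∘ ⇑(swap v p * swap p w))
    (by simp [swap_apply_of_ne_of_ne, Ne.symm, *, -hup, -hpr, -hvp, -hpw])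
    (by simp [swap_apply_of_ne_of_ne, Ne.symm, *, -hup, -hpr, -hvp, -hpw])
    (by simp [swap_apply_of_ne_of_ne, *, -hup, -hpr, -hvp, -hpw])
  have r4 := BoardReach.pass (u := w) (p := p) (r := v) hd'.neg (by rw [hpw]; simp)
    (by rw [hvp]; simp) (i := i) (j := j)
    (f := ((f ∘ ⇑(swap u p * swap p r)) ∘ ⇑(swap v p * swap p w)) ∘ ⇑(swap r p * swap p u))
    (by simp [swap_apply_of_ne_of_ne, Ne.symm, *, -hup, -hpr, -hvp, -hpw])
    (by simp [swap_apply_of_ne_of_ne, *, -hup, -hpr, -hvp, -hpw])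
    (by simp [swap_apply_of_ne_of_ne, Ne.symm, *, -hup, -hpr, -hvp, -hpw])
  have := ((r1.trans r2).trans r3).trans r4
  rw [swap_comm r p, swap_comm p u, swap_comm w p, swap_comm p v] at this
  exact this

/-- A vacancy of the first orientation to the left of a site and a vacancy of the third orientation
below it (`ε = 1`) or above it (`ε = -1`) permute the electrons around the site. -/
theorem contentLinked_of_crossing (hf : ElectronInjective f) {ε : ℤ} (hε : ε = 1 ∨ ε = -1)
    {x y a b : ℤ} (ha : 1 ≤ a) (hb : 1 ≤ b) (hu : f (x - a, y) = .inl 0)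
    (hv : f (x, y - ε * b) = .inl 2)
    (hrow : ∀ t, -a < t → t ≤ 1 → ∃ j, f (x + t, y) = .inr j)
    (hcol : ∀ t, -b < t → t ≤ 1 → t ≠ 0 → ∃ j, f (x, y + ε * t) = .inr j) :
    ContentLinked (labelGroup f) (f (x, y)) (f (x + 1, y)) ∧
      ContentLinked (labelGroup f) (f (x, y)) (f (x, y + ε)) := by
  have hd : IsMove 0 (1, 0) := .inl ⟨rfl, .inl rfl⟩
  have hd' : IsMove 2 (0, ε) := by rcases hε with rfl | rfl <;> simp [IsMove]
  have hε0 : ε ≠ 0 := by rcases hε with rfl | rfl <;> norm_num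
  have hq (z t : ℤ) : (z, y) + t • ((1, 0) : ℤ × ℤ) = (z + t, y) := by simp
  have hq' (z t : ℤ) : (x, z) + t • ((0, ε) : ℤ × ℤ) = (x, z + ε * t) := by simp [mul_comm]
  obtain ⟨i, hi⟩ := hrow 0 (by omega) (by omega)
  obtain ⟨j, hj⟩ := hrow 1 (by omega) (by omega)
  obtain ⟨k, hk⟩ := hcol 1 (by omega) (by omega) (by omega)
  simp only [add_zero, mul_one] at hi hj hk
  -- Both vacancies are first pulled up to the site itself; this leaves the electrons at the site
  -- and at its two onward neighbours in place.
  obtain ⟨g, hg, -, g2, g3⟩ := exists_pull hd (a - 1).toNat (x - a, y) hu fun t ht ht' => by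
    rw [hq, show x - a + t = x + (t - a) by ring]
    exact hrow _ (by omega) (by omega)
  have g3' (X Y : ℤ) (h : Y ≠ y ∨ x ≤ X) : g (X, Y) = f (X, Y) := by
    refine g3 _ fun t ht ht' => ?_
    rw [hq, Ne, Prod.mk.injEq]
    omega
  rw [hq, Int.toNat_of_nonneg (by omega)] at g2
  obtain ⟨g', hg', -, g2', g3''⟩ := exists_pull (f := g) hd' (b - 1).toNat (x, y - ε * b)
    (by rw [g3' _ _ (.inr le_rfl), hv]) fun t ht ht' => by
      rw [hq', g3' _ _ (.inr le_rfl), show y - ε * b + ε * t = y + ε * (t - b) by ring]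
      exact hcol _ (by omega) (by omega) (by omega)
  have g4 (X Y : ℤ) (h : X ≠ x ∨ Y = y ∨ Y = y + ε) : g' (X, Y) = g (X, Y) := by
    refine g3'' _ fun t ht ht' => ?_
    rw [hq', Ne, Prod.mk.injEq]
    rcases hε with rfl | rfl <;> omega
  rw [hq', Int.toNat_of_nonneg (by omega)] at g2'
  have hlink := mem_labelGroup_of_adjacent_vacancies (f := g') (u := (x - 1, y)) (v := (x, y - ε))
    (p := (x, y)) (r := (x + 1, y)) (w := (x, y + ε)) (i := i) (j := j) (k := k)
    ((hf.of_reach hg).of_reach hg') hd hd'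
    (by simp; rcases hε with rfl | rfl <;> omega) (by simp) (by simp) (by simp) (by simp)
    (by rw [g4 _ _ (by omega), ← g2, show x - a + (a - 1) = x - 1 by ring])
    (by rw [← g2', show y - ε * b + ε * (b - 1) = y - ε by ring])
    (by rw [g4 _ _ (by omega), g3' _ _ (by omega), hi])
    (by rw [g4 _ _ (by omega), g3' _ _ (by omega), hj])
    (by rw [g4 _ _ (by omega), g3' _ _ (by omega), hk])
  rw [← labelGroup_eq hg', ← labelGroup_eq hg] at hlink
  have hij : i ≠ j := by
    rintro rfl
    simpa using hf _ _ _ hi hj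
  have hik : k ≠ i := by
    rintro rfl
    simpa [hε0] using hf _ _ _ hi hk
  have hjk : j ≠ k := by
    rintro rfl
    simpa using hf _ _ _ hj hk
  refine ⟨⟨i, j, hi, hj, .inr ⟨k, hij, hjk, hik, hlink⟩⟩, ⟨i, k, hi, hk, Linked.symm ?_⟩⟩
  exact .inr ⟨j, hik, hij, hjk, by rwa [swap_mul_swap_rotate hik hjk]⟩

theorem contentLinked_of_crossing_below (hf : ElectronInjective f) {x y x₀ y₀ : ℤ} (hx : x₀ < x)
    (hy : y₀ < y) (hu : f (x₀, y) = .inl 0) (hv : f (x, y₀) = .inl 2)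
    (hrow : ∀ X, x₀ < X → X ≤ x + 1 → ∃ j, f (X, y) = .inr j)
    (hcol : ∀ Y, y₀ < Y → Y ≤ y + 1 → Y ≠ y → ∃ j, f (x, Y) = .inr j) :
    ContentLinked (labelGroup f) (f (x, y)) (f (x + 1, y)) ∧
      ContentLinked (labelGroup f) (f (x, y)) (f (x, y + 1)) :=
  contentLinked_of_crossing hf (.inl rfl) (a := x - x₀) (b := y - y₀) (by omega) (by omega)
    (by rwa [sub_sub_cancel]) (by rwa [one_mul, sub_sub_cancel])
    (fun _ _ _ => hrow _ (by omega) (by omega))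
    (fun _ _ _ _ => hcol _ (by omega) (by omega) (by omega))

end Crossing

end Vacancy

namespace Vacancy

/-! ### Linking all electrons of the staircase region -/

section Staircase

open Equiv Relation

variable {N : ℕ} {f : Board N} {m₁ m₃ δ H : ℤ}

/-- The part of the canonical vacancy configuration to which the dynamics on a board applies.  The
origin is shifted by `(m₁, m₃)`. -/
structure IsStaircase (f : Board N) (m₁ m₃ δ H : ℤ) : Prop where
  one_le : 1 ≤ m₁
  le : m₁ ≤ m₃
  two_le : 2 ≤ δ
  le_height : m₁ + δ ≤ H
  add_two_le_height : m₃ + 2 ≤ H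
  disjoint : m₁ ≤ δ ∨ m₃ + 1 ≤ m₁ + δ
  injective : ElectronInjective f
  left : ∀ X Y, 1 - m₁ ≤ X → X ≤ 0 → 1 ≤ Y → Y ≤ H → f (X, Y) = .inl 0
  block : ∀ X Y, 1 ≤ X → X ≤ m₁ → 1 ≤ Y → Y ≤ m₃ → f (X, Y) = .inl 2
  bottom : ∀ X Y, m₁ < X → X ≤ m₃ + δ → 1 - m₃ ≤ Y → Y ≤ 0 → f (X, Y) = .inl 2
  electron : ∀ X Y, 1 ≤ X → X ≤ m₃ + δ → 1 ≤ Y → Y ≤ H → (X ≤ δ ∨ Y ≤ m₁ + δ) →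
    (m₁ < X ∨ m₃ < Y) → ∃ j, f (X, Y) = .inr j

/-- A block of vacancies of the third orientation moves up past `n` rows of electrons. -/
theorem exists_raise (x : ℕ) {y n : ℤ} (hy : 0 ≤ y) (hn : 0 ≤ n)
    (hv : ∀ X Y : ℤ, 1 ≤ X → X ≤ x → 1 ≤ Y → Y ≤ y → f (X, Y) = .inl 2)
    (he : ∀ X Y : ℤ, 1 ≤ X → X ≤ x → y < Y → Y ≤ y + n → ∃ j, f (X, Y) = .inr j) :
    ∃ f', BoardReach f f' ∧
      (∀ X Y : ℤ, 1 ≤ X → X ≤ x → y < Y → Y ≤ y + n → f' (X, Y - y) = f (X, Y)) ∧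
      (∀ X Y : ℤ, 1 ≤ X → X ≤ x → n < Y → Y ≤ y + n → f' (X, Y) = .inl 2) ∧
      ∀ X Y : ℤ, (X < 1 ∨ x < X ∨ Y < 1 ∨ y + n < Y) → f' (X, Y) = f (X, Y) := by
  induction x with
  | zero => exact ⟨f, ReflTransGen.refl, fun X Y _ _ => by push_cast at *; omega,
      fun X Y _ _ => by push_cast at *; omega, fun _ _ _ => rfl⟩
  | succ x ih =>
    push_cast at hv he ⊢
    obtain ⟨g, hg, h1, h2, h3⟩ := ih (fun X Y _ _ => hv X Y (by omega) (by omega))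
      (fun X Y _ _ => he X Y (by omega) (by omega))
    obtain ⟨g', hg', h1', h2', h3'⟩ := exists_pull_column (f := g) (x + 1) y (y + n) y hy
      (by omega) (fun Y _ _ => by rw [h3 _ _ (by omega)]; apply hv <;> omega)
      (fun Y _ _ => by rw [h3 _ _ (by omega)]; apply he <;> omega)
    refine ⟨g', hg.trans hg', fun X Y _ _ _ _ => ?_, fun X Y _ _ _ _ => ?_, fun X Y _ => ?_⟩
    · rcases eq_or_ne X (x + 1) with rfl | hX
      · rw [h1' Y (by omega) (by omega), h3 _ _ (by omega)]
      · rw [h3' _ _ (by omega), h1 X Y (by omega) (by omega) (by omega) (by omega)]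
    · rcases eq_or_ne X (x + 1) with rfl | hX
      · rw [h2' Y (by omega) (by omega)]
      · rw [h3' _ _ (by omega), h2 X Y (by omega) (by omega) (by omega) (by omega)]
    · rw [h3' _ _ (by omega), h3 _ _ (by omega)]

namespace IsStaircase

variable (hf : IsStaircase f m₁ m₃ δ H)
include hf

theorem exists_raise {n : ℤ} (hn : 0 ≤ n) (hnH : m₃ + n ≤ H) (hn' : m₁ ≤ δ ∨ m₃ + n ≤ m₁ + δ) :
    ∃ f', BoardReach f f' ∧
      (∀ X Y : ℤ, 1 ≤ X → X ≤ m₁ → m₃ < Y → Y ≤ m₃ + n → f' (X, Y - m₃) = f (X, Y)) ∧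
      (∀ X Y : ℤ, 1 ≤ X → X ≤ m₁ → n < Y → Y ≤ m₃ + n → f' (X, Y) = .inl 2) ∧
      ∀ X Y : ℤ, (X < 1 ∨ m₁ < X ∨ Y < 1 ∨ m₃ + n < Y) → f' (X, Y) = f (X, Y) := by
  have := hf.one_le
  have := hf.le
  have := hf.two_le
  lift m₁ to ℕ using by omega
  exact Vacancy.exists_raise m₁ (by omega) hn hf.block fun X Y _ _ _ _ => by
    apply hf.electron <;> omega

/-- The site above (X, m₃ + 1) may lie outside the electron region. Hence X - 1 horizontal vacancies
first shift the row to the left, so that the two electrons come to columns 1 and 2; the crossing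
takes place in column 1, where δ ≥ 2 provides the electrons needed. -/
theorem linked_row {X : ℤ} (hX : 1 ≤ X) (hX' : X ≤ m₁)
    (h : X + 1 ≤ δ ∨ m₃ + 1 ≤ m₁ + δ) :
    ContentLinked (labelGroup f) (f (X, m₃ + 1)) (f (X + 1, m₃ + 1)) := by
  obtain ⟨h1, h2, h3, h4, h5, h6, hinj, hl, hb, -, he⟩ := hf
  obtain ⟨g, hg, g1, g2⟩ := exists_pull_row (f := f) 0 (X + 1) (m₃ + 1) (X - 1) (by omega)
    (by omega) (fun x _ _ => by apply hl <;> omega) (fun x _ _ => by apply he <;> omega)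
  have := (contentLinked_of_crossing_below (hinj.of_reach hg) (x := 1) (y := m₃ + 1)
    (x₀ := 1 - X) (y₀ := m₃) (by omega) (by omega)
    (by rw [g2 _ _ (by omega)]; apply hl <;> omega) (by rw [g2 _ _ (by omega)]; apply hb <;> omega)
    (fun x _ _ => ?_) (fun Y _ _ _ => by rw [g2 _ _ (by omega)]; apply he <;> omega)).1
  · rw [← labelGroup_eq hg] at this
    have e1 := g1 X (by omega) (by omega)
    have e2 := g1 (X + 1) (by omega) (by omega)
    rw [show X - (X - 1) = 1 by ring] at e1
    rw [show X + 1 - (X - 1) = 1 + 1 by ring] at e2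
    rwa [e1, e2] at this
  · rw [show x = x + (X - 1) - (X - 1) by ring, g1 _ (by omega) (by omega)]
    apply he <;> omega

/-- One vertical vacancy pulled up through column X lowers the electron at (X, Y) by one, next to
the one at (X - 1, Y - 1), where a crossing links them. -/
theorem linked_diagonal {X Y : ℤ} (hX : 2 ≤ X) (hX' : X ≤ m₃ + δ) (hY : m₃ + 1 < Y) (hY' : Y ≤ H)
    (h : X ≤ δ ∨ Y ≤ m₁ + δ) :
    ContentLinked (labelGroup f) (f (X - 1, Y - 1)) (f (X, Y)) := by
  obtain ⟨h1, h2, h3, h4, h5, h6, hinj, hl, hb, hbot, he⟩ := hf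
  -- The height of the top 3-vacancy in a column: m₃ in the columns of the block, 0 to the right of
  -- it.
  have key (X : ℤ) (h : 1 ≤ X) (h' : X ≤ m₃ + δ) : ∃ y, 0 ≤ y ∧ y ≤ m₃ ∧ f (X, y) = .inl 2 ∧
      ((X ≤ m₁ ∧ y = m₃) ∨ (m₁ < X ∧ y = 0)) := by
    rcases le_or_gt X m₁ with hX | hX
    · exact ⟨m₃, by omega, le_rfl, by apply hb <;> omega, by omega⟩
    · exact ⟨0, by omega, by omega, by apply hbot <;> omega, by omega⟩
  obtain ⟨y, hy, hy', hyv, hyX⟩ := key X (by omega) (by omega)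
  obtain ⟨z, hz, hz', hzv, hzX⟩ := key (X - 1) (by omega) (by omega)
  obtain ⟨g, hg, g1, -, g2⟩ := exists_pull_column (f := f) X y Y 1 (by omega)
    (by omega) (fun t _ _ => by rwa [show t = y by omega]) (fun t _ _ => by apply he <;> omega)
  have := (contentLinked_of_crossing_below (hinj.of_reach hg) (x := X - 1) (y := Y - 1)
    (x₀ := 0) (y₀ := z) (by omega) (by omega)
    (by rw [g2 _ _ (by omega)]; apply hl <;> omega) (by rw [g2 _ _ (by omega), hzv])
    (fun x _ _ => ?_) (fun t _ _ _ => by rw [g2 _ _ (by omega)]; apply he <;> omega)).1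
  · rwa [← labelGroup_eq hg, g2 _ _ (by omega), sub_add_cancel, g1 Y (by omega) (by omega)] at this
  · rcases eq_or_ne x X with rfl | hx
    · rw [g1 Y (by omega) (by omega)]
      apply he <;> omega
    · rw [g2 _ _ (by omega)]
      apply he <;> omega

theorem linked_first_column {Y : ℤ} (hY : m₃ + 1 < Y) (hY' : Y ≤ H) :
    ContentLinked (labelGroup f) (f (1, Y - 1)) (f (1, Y)) := by
  obtain ⟨h1, h2, h3, h4, h5, h6, hinj, hl, hb, hbot, he⟩ := hf
  have := (contentLinked_of_crossing_below hinj (x := 1) (y := Y - 1)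
    (x₀ := 0) (y₀ := m₃) (by omega) (by omega) (by apply hl <;> omega) (by apply hb <;> omega)
    (fun x _ _ => by apply he <;> omega) (fun t _ _ _ => by apply he <;> omega)).2
  rwa [sub_add_cancel] at this

/-- Here (m₁ + 1, m₃ + 1) is outside the electron region, so `linked_row` is not available in column
m₁. Raising the block by two drops two rows of electrons to the bottom, and a crossing at (m₁, 2)
with a vertical vacancy coming from above joins them to column m₁ + 1. -/
theorem linked_corner (h : m₁ = δ) (h' : m₁ + δ ≤ m₃) :
    ContentLinked (labelGroup f) (f (m₁, m₃ + 1)) (f (m₁ + 1, 2)) := by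
  obtain ⟨g, hg, g1, g2, g3⟩ := hf.exists_raise (n := 2) (by omega) hf.add_two_le_height
    (.inl h.le)
  obtain ⟨h1, h2, h3, h4, h5, h6, hinj, hl, hb, hbot, he⟩ := hf
  have hlow (X Y : ℤ) (hX : 1 ≤ X) (hX' : X ≤ m₁) (hY : 1 ≤ Y) (hY' : Y ≤ 2) :
      g (X, Y) = f (X, Y + m₃) := by
    rw [← g1 X (Y + m₃) (by omega) (by omega) (by omega) (by omega), add_sub_cancel_right]
  have := contentLinked_of_crossing (hinj.of_reach hg) (.inr rfl) (x := m₁) (y := 2) (a := m₁)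
    (b := 1) (by omega) (by omega) (by rw [g3 _ _ (by omega)]; apply hl <;> omega)
    (by apply g2 <;> omega) (fun t _ _ => ?_) (fun t _ _ _ => ?_)
  · have := this.2.symm.trans this.1
    rwa [← labelGroup_eq hg, hlow _ _ (by omega) (by omega) (by omega) (by omega),
      g3 _ _ (by omega), show (2 + -1 + m₃ : ℤ) = m₃ + 1 by ring] at this
  · rcases eq_or_ne t 1 with rfl | ht
    · rw [g3 _ _ (by omega)]
      apply he <;> omega
    · rw [hlow _ _ (by omega) (by omega) (by omega) (by omega)]
      apply he <;> omega
  · rw [hlow _ _ (by omega) (by omega) (by omega) (by omega)]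
    apply he <;> omega

/-- Raising the block by one row opens row 1 to the horizontal vacancies. Vertical vacancies from
below then lower any electron to the height of a crossing in that row. -/
theorem linked_bottom {X Y : ℤ} (hX : m₁ < X) (hX' : X ≤ m₃ + δ) (hY : 1 ≤ Y) (hY' : Y ≤ m₃ + 1)
    (h : X ≤ δ ∨ Y ≤ m₁ + δ) :
    ContentLinked (labelGroup f) (f (X, Y)) (f (m₁ + 1, 1)) := by
  obtain ⟨g, hg, g1, -, g3⟩ := hf.exists_raise (n := 1) (by omega)
    (by have := hf.add_two_le_height; omega) hf.disjoint
  obtain ⟨h1, h2, h3, h4, h5, h6, hinj, hl, hb, hbot, he⟩ := hf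
  have hginj := hinj.of_reach hg
  have hrow (x : ℤ) (hx : 1 ≤ x) (hx' : x ≤ m₃ + δ) : ∃ j, g (x, 1) = .inr j := by
    rcases le_or_gt x m₁ with hm | hm
    · have := g1 x (m₃ + 1) (by omega) (by omega) (by omega) (by omega)
      rw [add_sub_cancel_left] at this
      rw [this]
      apply he <;> omega
    · rw [g3 _ _ (by omega)]
      apply he <;> omega
  -- Lowering column x + 1 by s puts the electron at (x + 1, 1 + s) beside (x, 1).
  have hB (x s : ℤ) (hx : m₁ < x) (hx' : x + 1 ≤ m₃ + δ) (hs : 0 ≤ s) (hs' : s ≤ m₃)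
      (h : x + 1 ≤ δ ∨ 1 + s ≤ m₁ + δ) :
      ContentLinked (labelGroup f) (f (x, 1)) (f (x + 1, 1 + s)) := by
    obtain ⟨g', hg', g1', -, g2'⟩ := exists_pull_column (f := g) (x + 1) 0 (1 + s) s hs (by omega)
      (fun t _ _ => by rw [g3 _ _ (by omega)]; apply hbot <;> omega)
      (fun t _ _ => by rw [g3 _ _ (by omega)]; apply he <;> omega)
    have e1 := g1' (1 + s) (by omega) (by omega)
    rw [add_sub_cancel_right] at e1
    have := (contentLinked_of_crossing_below (hginj.of_reach hg') (x := x) (y := 1)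
      (x₀ := 0) (y₀ := 0) (by omega) (by omega)
      (by rw [g2' _ _ (by omega), g3 _ _ (by omega)]; apply hl <;> omega)
      (by rw [g2' _ _ (by omega), g3 _ _ (by omega)]; apply hbot <;> omega)
      (fun X _ _ => ?_)
      (fun t _ _ _ => by
        rw [g2' _ _ (by omega), g3 _ _ (by omega)]; apply he <;> omega)).1
    · rwa [← labelGroup_eq hg', ← labelGroup_eq hg, g2' _ _ (by omega), g3 _ _ (by omega), e1,
        g3 _ _ (by omega)] at this
    · rcases eq_or_ne X (x + 1) with rfl | hXx
      · rw [e1, g3 _ _ (by omega)]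
        apply he <;> omega
      · rw [g2' _ _ (by omega)]
        exact hrow _ (by omega) (by omega)
  -- Column m₁ + 1 is lowered by s and the crossing is in this very column; s < m₃ leaves a vertical
  -- vacancy below for it.
  have hA (s : ℤ) (hs : 0 ≤ s) (hs' : s < m₃) (h : m₁ + 1 ≤ δ ∨ 2 + s ≤ m₁ + δ) :
      ContentLinked (labelGroup f) (f (m₁ + 1, 1 + s)) (f (m₁ + 1, 2 + s)) := by
    obtain ⟨g', hg', g1', -, g2'⟩ := exists_pull_column (f := g) (m₁ + 1) 0 (2 + s) s hs (by omega)
      (fun t _ _ => by rw [g3 _ _ (by omega)]; apply hbot <;> omega)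
      (fun t _ _ => by rw [g3 _ _ (by omega)]; apply he <;> omega)
    have e (t : ℤ) (ht : -s < t) (ht' : t ≤ 2) : g' (m₁ + 1, t) = f (m₁ + 1, t + s) := by
      rw [← g3 _ _ (by omega), ← g1' (t + s) (by omega) (by omega), add_sub_cancel_right]
    have := (contentLinked_of_crossing_below (hginj.of_reach hg') (x := m₁ + 1) (y := 1)
      (x₀ := 0) (y₀ := -s) (by omega) (by omega)
      (by rw [g2' _ _ (by omega), g3 _ _ (by omega)]; apply hl <;> omega)
      (by rw [g2' _ _ (by omega), g3 _ _ (by omega)]; apply hbot <;> omega)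
      (fun X _ _ => ?_)
      (fun t _ _ _ => by rw [e _ (by omega) (by omega)]; apply he <;> omega)).2
    · rwa [← labelGroup_eq hg', ← labelGroup_eq hg, e _ (by omega) (by omega),
        e _ (by omega) (by omega)] at this
    · rcases eq_or_ne X (m₁ + 1) with rfl | hXx
      · rw [e _ (by omega) (by omega)]
        apply he <;> omega
      · rw [g2' _ _ (by omega)]
        exact hrow _ (by omega) (by omega)
  have hfirst (n : ℕ) : m₁ + 1 + n ≤ m₃ + δ →
      ContentLinked (labelGroup f) (f (m₁ + 1 + n, 1)) (f (m₁ + 1, 1)) := by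
    induction n with
    | zero =>
      intro _
      obtain ⟨j, hj⟩ := he (m₁ + 1) 1 (by omega) (by omega) (by omega) (by omega) (by omega)
        (by omega)
      exact ⟨j, j, by simpa using hj, hj, .inl rfl⟩
    | succ n ih =>
      intro hn
      push_cast at hn ⊢
      rw [← add_assoc]
      have := hB (m₁ + 1 + n) 0 (by omega) (by omega) le_rfl (by omega) (by omega)
      rw [add_zero] at this
      exact this.symm.trans (ih (by omega))
  have hcolumn (n : ℕ) : (n : ℤ) ≤ m₃ → (m₁ + 1 ≤ δ ∨ 1 + n ≤ m₁ + δ) →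
      ContentLinked (labelGroup f) (f (m₁ + 1, 1 + n)) (f (m₁ + 1, 1)) := by
    induction n with
    | zero =>
      intro _ _
      simpa using hfirst 0 (by push_cast; omega)
    | succ n ih =>
      intro hn hn'
      push_cast at hn hn' ⊢
      have := hA n (by omega) (by omega) (by omega)
      rw [show (1 + (n + 1) : ℤ) = 2 + n by ring]
      exact this.symm.trans (ih (by omega) (by omega))
  rcases eq_or_ne X (m₁ + 1) with rfl | hXm
  · have := hcolumn (Y - 1).toNat (by omega) (by omega)
    rwa [Int.toNat_of_nonneg (by omega), add_sub_cancel] at this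
  · have e1 := hB (X - 1) (Y - 1) (by omega) (by omega) (by omega) (by omega) (by omega)
    have e2 := hfirst (X - 1 - (m₁ + 1)).toNat (by omega)
    rw [Int.toNat_of_nonneg (by omega), add_sub_cancel] at e2
    rw [sub_add_cancel, add_sub_cancel] at e1
    exact e1.symm.trans e2

theorem linked_base_row {X : ℤ} (hX : 1 ≤ X) (hX' : X ≤ m₃ + δ)
    (h : X ≤ δ ∨ m₃ + 1 ≤ m₁ + δ) :
    ContentLinked (labelGroup f) (f (X, m₃ + 1)) (f (m₁ + 1, 1)) := by
  have h1 := hf.one_le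
  have h2 := hf.le
  have h3 := hf.two_le
  have h4 := hf.disjoint
  rcases lt_or_ge m₁ X with hXm | hXm
  · exact hf.linked_bottom hXm hX' (by omega) le_rfl h
  have key (n : ℕ) : (n : ℤ) < m₁ →
      ContentLinked (labelGroup f) (f (m₁ - n, m₃ + 1)) (f (m₁ + 1, 1)) := by
    induction n with
    | zero =>
      intro _
      rw [Nat.cast_zero, sub_zero]
      by_cases hm : m₁ + 1 ≤ δ ∨ m₃ + 1 ≤ m₁ + δ
      · exact (hf.linked_row h1 le_rfl hm).trans
          (hf.linked_bottom (by omega) (by omega) (by omega) le_rfl hm)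
      · exact (hf.linked_corner (by omega) (by omega)).trans
          (hf.linked_bottom (by omega) (by omega) (by omega) (by omega) (by omega))
    | succ n ih =>
      intro hn
      push_cast at hn ⊢
      have := hf.linked_row (X := m₁ - (n + 1)) (by omega) (by omega) (by omega)
      rw [show m₁ - (n + 1) + 1 = m₁ - n by ring] at this
      exact this.trans (ih (by omega))
  have := key (m₁ - X).toNat (by omega)
  rwa [Int.toNat_of_nonneg (by omega), sub_sub_cancel] at this

/-- Descent to row m₃ + 1 along diagonals, and vertically in column 1; a step down and to the left
stays in the region. -/
theorem linked_top {X : ℤ} (n : ℕ) (hX : 1 ≤ X) (hX' : X ≤ m₃ + δ) (hn : m₃ + 1 + n ≤ H)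
    (h : X ≤ δ ∨ m₃ + 1 + n ≤ m₁ + δ) :
    ContentLinked (labelGroup f) (f (X, m₃ + 1 + n)) (f (m₁ + 1, 1)) := by
  have h3 := hf.two_le
  induction n generalizing X with
  | zero => simpa using hf.linked_base_row hX hX' (by simpa using h)
  | succ n ih =>
    push_cast at hn h ⊢
    rw [← add_assoc]
    rcases eq_or_ne X 1 with rfl | hX1
    · have := hf.linked_first_column (Y := m₃ + 1 + n + 1) (by omega) (by omega)
      rw [add_sub_cancel_right] at this
      exact this.symm.trans (ih hX hX' (by omega) (by omega))
    · have := hf.linked_diagonal (X := X) (Y := m₃ + 1 + n + 1) (by omega) hX' (by omega)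
        (by omega) (by omega)
      rw [add_sub_cancel_right] at this
      exact this.symm.trans (ih (by omega) (by omega) (by omega) (by omega))

theorem alternatingGroup_le (hcover : ∀ j, ∃ X Y, 1 ≤ X ∧ X ≤ m₃ + δ ∧ 1 ≤ Y ∧ Y ≤ H ∧
      (X ≤ δ ∨ Y ≤ m₁ + δ) ∧ (m₁ < X ∨ m₃ < Y) ∧ f (X, Y) = .inr j) :
    alternatingGroup (Fin N) ≤ labelGroup f := by
  have key (j : Fin N) : ContentLinked (labelGroup f) (.inr j) (f (m₁ + 1, 1)) := by
    obtain ⟨X, Y, h1, h2, h3, h4, h5, h6, hj⟩ := hcover j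
    rw [← hj]
    rcases le_or_gt Y m₃ with hY | hY
    · exact hf.linked_bottom (by omega) h2 h3 (by omega) h5
    · have := hf.linked_top (X := X) (Y - (m₃ + 1)).toNat h1 h2 (by omega) (by omega)
      rwa [Int.toNat_of_nonneg (by omega), add_sub_cancel] at this
  refine alternatingGroup_le_of_forall_linked fun i j => ?_
  obtain ⟨i', j', hi, hj, h⟩ := (key i).trans (key j).symm
  rw [Sum.inr.injEq] at hi hj
  rwa [hi, hj]

end IsStaircase

end Staircase

end Vacancy

namespace Vacancy

/-! ### From boards to the periodic lattice -/

section Transfer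

open Equiv Relation

variable {L N : ℕ}

/-- Exchange of the objects at two sites. -/
def Config.swapSites (c : Config L N) (r s : Site L) : Config L N where
  pos := swap r s ∘ c.pos
  vac := c.vac ∘ swap r s
  pos_injective := (swap r s).injective.comp c.pos_injective
  vac_eq_none_iff x := by
    simp only [Function.comp_apply, c.vac_eq_none_iff, swap_apply_eq_iff]

theorem hop_swapSites {c : Config L N} {r : Site L} {α : Fin 3} {j : Fin N} (hj : c.pos j = r)
    (hα : c.vac (r + e L α) = some α) : Hop c (c.swapSites r (r + e L α)) :=
  ⟨r, α, j, hj, hα, (update_pos_eq hj hα).symm, (update_vac_eq hj hα).symm⟩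

theorem connected_swapSites {c : Config L N} {r s : Site L} {α : Fin 3} {j : Fin N}
    (hj : c.pos j = s) (hα : c.vac r = some α) (h : s = r + e L α ∨ s = r - e L α) :
    Connected c (c.swapSites r s) := by
  refine ReflTransGen.single ?_
  rcases h with rfl | rfl
  -- A vacancy that advances along + e_α is the reverse of a hop, so the hop is read from the
  -- swapped configuration.
  · right
    have := hop_swapSites (c := c.swapSites r (r + e L α)) (r := r) (α := α) (j := j)
      (by simp [Config.swapSites, hj]) (by simp [Config.swapSites, hα])
    convert this
    ext <;> simp [Config.swapSites]
  · left
    have := hop_swapSites (α := α) hj (by rwa [sub_add_cancel])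
    rw [sub_add_cancel] at this
    convert this using 1
    rw [Config.swapSites, Config.swapSites]
    simp only [swap_comm]

theorem Connected.symm {c c' : Config L N} (h : Connected c c') : Connected c' c := by
  induction h with
  | refl => exact ReflTransGen.refl
  | tail _ hs ih => exact ReflTransGen.head hs.symm ih

theorem Hop.permute {c c' : Config L N} (h : Hop c c') (π : Perm (Fin N)) :
    Hop (c.permute π) (c'.permute π) := by
  obtain ⟨r, α, j, hj, hα, hp, hv⟩ := h
  refine ⟨r, α, π.symm j, by simpa [Config.permute] using hj, hα, ?_, hv⟩
  funext i
  simp only [Config.permute, hp, Function.comp_apply, Function.update_apply]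
  exact if_congr (by rw [eq_symm_apply]) rfl rfl

theorem Connected.permute {c c' : Config L N} (h : Connected c c') (π : Perm (Fin N)) :
    Connected (c.permute π) (c'.permute π) := by
  induction h with
  | refl => exact ReflTransGen.refl
  | tail _ hs ih => exact ReflTransGen.tail ih (hs.imp (·.permute π) (·.permute π))

/-- A chart of the lattice by a part of the planar lattice, in which orientations are relabelled
by `τ`. -/
structure IsChart (τ : Perm (Fin 3)) (site : ℤ × ℤ → Site L) (box : Set (ℤ × ℤ)) : Prop where
  injOn : Set.InjOn site box
  surjective : ∀ r, ∃ a ∈ box, site a = r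
  move : ∀ a d α, IsMove α d →
    site (a + d) = site a + e L (τ α) ∨ site (a + d) = site a - e L (τ α)

/-- The board shows the configuration in the chart. -/
structure Represents (τ : Perm (Fin 3)) (site : ℤ × ℤ → Site L) (box : Set (ℤ × ℤ))
    (c : Config L N) (f : Board N) : Prop where
  outside : ∀ a, a ∉ box → f a = .inl 1
  vacancy : ∀ a ∈ box, ∀ α, f a = .inl α → c.vac (site a) = some (τ α)
  electron : ∀ a j, f a = .inr j → c.pos j = site a

variable {τ : Perm (Fin 3)} {site : ℤ × ℤ → Site L} {box : Set (ℤ × ℤ)} {c : Config L N}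
  {f f' : Board N}

theorem Represents.mem_box (h : Represents τ site box c f) {a : ℤ × ℤ} {j : Fin N}
    (ha : f a = .inr j) : a ∈ box := by
  by_contra hbox
  rw [h.outside a hbox] at ha
  simp at ha

theorem Represents.electronInjective (h : Represents τ site box c f) (hs : IsChart τ site box) :
    ElectronInjective f := fun a b j ha hb =>
  hs.injOn (h.mem_box ha) (h.mem_box hb) ((h.electron a j ha).symm.trans (h.electron b j hb))

theorem Represents.exists_eq_inr (h : Represents τ site box c f) (hs : IsChart τ site box)
    (j : Fin N) : ∃ a ∈ box, site a = c.pos j ∧ f a = .inr j := by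
  obtain ⟨a, ha, haj⟩ := hs.surjective (c.pos j)
  refine ⟨a, ha, haj, ?_⟩
  rcases hfa : f a with α | i
  · have := h.vacancy a ha α hfa
    rw [haj, (c.vac_eq_none_iff _).mpr ⟨j, rfl⟩] at this
    simp at this
  · rw [c.pos_injective ((h.electron a i hfa).trans haj)]

/-- Sites outside the box carry immobile 2-vacancies, so a board move involves only sites of the
box, where the chart is injective; periodic images do not interfere. -/
theorem Represents.exists_of_step (h : Represents τ site box c f) (hs : IsChart τ site box)
    (hstep : BoardStep f f') : ∃ c', Connected c c' ∧ Represents τ site box c' f' := by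
  obtain ⟨a, d, α, j, hd, ha, hj, rfl⟩ := hstep
  have hbox : a ∈ box := by
    by_contra hbox
    rw [h.outside a hbox, Sum.inl.injEq] at ha
    subst ha
    simp [IsMove] at hd
  have hbox' := h.mem_box hj
  have hne (x) (hx : x ∉ box) : swap a (a + d) x = x :=
    swap_apply_of_ne_of_ne (fun h => hx (h ▸ hbox)) (fun h => hx (h ▸ hbox'))
  have hswap (x) (hx : x ∈ box) :
      swap (site a) (site (a + d)) (site x) = site (swap a (a + d) x) := by
    rcases eq_or_ne x a with rfl | hxa
    · simp
    rcases eq_or_ne x (a + d) with rfl | hxb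
    · simp
    rw [swap_apply_of_ne_of_ne hxa hxb, swap_apply_of_ne_of_ne (hs.injOn.ne hx hbox hxa)
      (hs.injOn.ne hx hbox' hxb)]
  have hmem (x) (hx : x ∈ box) : swap a (a + d) x ∈ box := by
    rcases eq_or_ne x a with rfl | hxa
    · simpa
    rcases eq_or_ne x (a + d) with rfl | hxb
    · simpa
    rwa [swap_apply_of_ne_of_ne hxa hxb]
  refine ⟨c.swapSites (site a) (site (a + d)), connected_swapSites (h.electron _ j hj)
    (h.vacancy a hbox α ha) (hs.move a d α hd), ⟨fun x hx => ?_, fun x hx β hβ => ?_,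
    fun x i hi => ?_⟩⟩
  · rw [Function.comp_apply, hne x hx, h.outside x hx]
  · change c.vac (swap _ _ (site x)) = _
    rw [hswap x hx]
    exact h.vacancy _ (hmem x hx) β hβ
  · have hx : x ∈ box := by
      by_contra hx
      rw [Function.comp_apply, hne x hx, h.outside x hx] at hi
      simp at hi
    change swap _ _ (c.pos i) = _
    rw [h.electron _ i hi, ← hswap x hx, swap_apply_self]

theorem Represents.exists_of_reach (h : Represents τ site box c f) (hs : IsChart τ site box)
    (hr : BoardReach f f') : ∃ c', Connected c c' ∧ Represents τ site box c' f' := by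
  induction hr with
  | refl => exact ⟨c, ReflTransGen.refl, h⟩
  | tail _ hstep ih =>
    obtain ⟨c₁, hc₁, h₁⟩ := ih
    obtain ⟨c₂, hc₂, h₂⟩ := h₁.exists_of_step hs hstep
    exact ⟨c₂, ReflTransGen.trans hc₁ hc₂, h₂⟩

theorem Represents.connected_permute (h : Represents τ site box c f) (hs : IsChart τ site box)
    {π : Perm (Fin N)} (hπ : π ∈ labelGroup f) : Connected c (c.permute π) := by
  -- In `c.permute π` electron j sits where π j sat, so the labels on the board change by π⁻¹.
  obtain ⟨c', hc', h'⟩ := h.exists_of_reach hs (inv_mem hπ)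
  convert hc'
  ext1
  · funext j
    obtain ⟨a, ha, haj, hfa⟩ := h.exists_eq_inr hs (π j)
    rw [h'.electron a j (by simp [relabel, hfa]), haj]
    rfl
  · funext r
    obtain ⟨a, ha, rfl⟩ := hs.surjective r
    rcases hfa : f a with α | j
    · rw [h'.vacancy a ha α (by simp [relabel, hfa])]
      exact h.vacancy a ha α hfa
    · rw [(c'.vac_eq_none_iff _).mpr ⟨π⁻¹ j, h'.electron a _ (by simp [relabel, hfa])⟩]
      exact (c.vac_eq_none_iff _).mpr ⟨j, h.electron a j hfa⟩

theorem exists_represents (c : Config L N) (τ : Perm (Fin 3)) (site : ℤ × ℤ → Site L)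
    (box : Set (ℤ × ℤ)) : ∃ f : Board N, Represents τ site box c f := by
  classical
  have h (a : ℤ × ℤ) : ∃ u : Fin 3 ⊕ Fin N, (a ∉ box → u = .inl 1) ∧
      (a ∈ box → ∀ α, u = .inl α → c.vac (site a) = some (τ α)) ∧
      ∀ j, u = .inr j → c.pos j = site a := by
    by_cases ha : a ∈ box
    · rcases hv : c.vac (site a) with _ | β
      · obtain ⟨j, hj⟩ := (c.vac_eq_none_iff _).mp hv
        exact ⟨.inr j, fun h => absurd ha h, by simp, fun i hi => by
          rwa [← Sum.inr.inj hi]⟩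
      · exact ⟨.inl (τ⁻¹ β), fun h => absurd ha h, fun _ α hα => by
          rw [← Sum.inl.inj hα]; simp, by simp⟩
    · exact ⟨.inl 1, fun _ => rfl, fun h => absurd h ha, by simp⟩
  choose f hf using h
  exact ⟨f, fun a => (hf a).1, fun a => (hf a).2.1, fun a => (hf a).2.2⟩

end Transfer

end Vacancy

namespace Vacancy

/-! ### The canonical vacancy configuration -/

section Canonical

variable {L : ℕ}

theorem intCast_mem_canonicalSites_zero_iff {m₁ m₂ m₃ x k : ℤ} (h₁ : 1 ≤ m₁) (h₃ : 1 ≤ m₃)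
    (h₁L : 2 * m₁ ≤ L) (h₃L : m₃ ≤ L) (hx : 1 ≤ x) (hx' : x ≤ L) (hk : 1 ≤ k) (hk' : k ≤ L) :
    (((x : ZMod L), (k : ZMod L)) : Site L) ∈ canonicalSites L m₁ m₂ m₃ 0 ↔
      (m₃ + 1 ≤ k ∧ x ≤ m₁) ∨ (k ≤ m₃ ∧ m₁ + 1 ≤ x ∧ x ≤ 2 * m₁) := by
  constructor
  · rintro ⟨i, j, hr, h⟩
    simp [e] at hr
    have h1 := eq_of_intCast_zmod_eq (x := 0) hr.1 (by omega) (by omega) (by omega) (by omega)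
    have h2 := eq_of_intCast_zmod_eq (x := 0) hr.2 (by omega) (by omega) (by omega) (by omega)
    omega
  · intro h
    exact ⟨x, k, by simp [e], by omega⟩

theorem intCast_mem_canonicalSites_two_iff {m₁ m₂ m₃ x k : ℤ} (h₁ : 1 ≤ m₁) (h₃ : 1 ≤ m₃)
    (h₁L : 2 * m₁ ≤ L) (h₃L : 2 * m₃ ≤ L) (hx : 1 ≤ x) (hx' : x ≤ L) (hk : 1 ≤ k) (hk' : k ≤ L) :
    (((x : ZMod L), (k : ZMod L)) : Site L) ∈ canonicalSites L m₁ m₂ m₃ 2 ↔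
      ((x ≤ m₁ ∨ 2 * m₁ + 1 ≤ x) ∧ k ≤ m₃) ∨
        (m₁ + 1 ≤ x ∧ x ≤ 2 * m₁ ∧ m₃ + 1 ≤ k ∧ k ≤ 2 * m₃) := by
  constructor
  · rintro ⟨i, j, hr, h⟩
    simp [e] at hr
    have h1 := eq_of_intCast_zmod_eq (x := 0) hr.1 (by omega) (by omega) (by omega) (by omega)
    have h2 := eq_of_intCast_zmod_eq (x := 0) hr.2 (by omega) (by omega) (by omega) (by omega)
    omega
  · intro h
    exact ⟨x, k, by simp [e], by omega⟩

/-- In the window the slanted strips along e₂ become two rectangles. The column i - 1 + j has to be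
reduced by L when it exceeds L. -/
theorem intCast_mem_canonicalSites_one_iff {m₁ m₂ m₃ x k : ℤ} (h₂ : 0 ≤ m₂) (h₃ : 1 ≤ m₃)
    (hL : m₂ + m₃ ≤ L) (hx : 1 ≤ x) (hx' : x ≤ L) (hk : 1 ≤ k) (hk' : k ≤ L) :
    (((x : ZMod L), (k : ZMod L)) : Site L) ∈ canonicalSites L m₁ m₂ m₃ 1 ↔
      (L - m₂ + 1 ≤ x ∧ m₃ + 1 ≤ k) ∨
        (L - m₂ - m₃ + 1 ≤ x ∧ x ≤ L - m₂ ∧ L - m₂ + 1 ≤ k) := by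
  constructor
  · rintro ⟨i, j, hr, h⟩
    simp [e] at hr
    have h2 := eq_of_intCast_zmod_eq (x := 0) hr.2 (by omega) (by omega) (by omega) (by omega)
    subst h2
    have h1 : ((x : ℤ) : ZMod L) = ((i - 1 + k : ℤ) : ZMod L) := by
      push_cast
      exact hr.1
    rcases le_or_gt (i - 1 + k) L with hi | hi
    · have := eq_of_intCast_zmod_eq (x := 0) h1 (by omega) (by omega) (by omega) (by omega)
      omega
    · have h1 : ((x : ℤ) : ZMod L) = ((i - 1 + k - L : ℤ) : ZMod L) := by
        rw [h1]
        simp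
      have := eq_of_intCast_zmod_eq (x := 0) h1 (by omega) (by omega) (by omega) (by omega)
      omega
  · intro h
    rcases le_or_gt k x with hkx | hkx
    · exact ⟨x - k + 1, k, by simp [e], by omega⟩
    · exact ⟨x - k + 1 + L, k, by simp [e], by omega⟩

end Canonical

/-! ### Planar charts of the torus -/

section Main

open Equiv

variable {L N : ℕ}

theorem isChart_of_isLatticeSymmetry [NeZero L] {A : Site L ≃+ Site L} {τ : Perm (Fin 3)}
    (hA : IsLatticeSymmetry A τ) (x₀ y₀ : ℤ) :
    IsChart τ (fun a => A ((a.1 + x₀ : ℤ), (a.2 + y₀ : ℤ)))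
      {a | 1 ≤ a.1 + x₀ ∧ a.1 + x₀ ≤ L ∧ 1 ≤ a.2 + y₀ ∧ a.2 + y₀ ≤ L} := by
  refine ⟨fun a ha b hb h => ?_, fun r => ?_, fun a d α hd => ?_⟩
  · have h := A.injective h
    rw [Prod.mk.injEq] at h
    obtain ⟨h1, h2, h3, h4⟩ := ha
    obtain ⟨h1', h2', h3', h4'⟩ := hb
    have e1 := eq_of_intCast_zmod_eq (x := 0) h.1 (by omega) (by omega) (by omega) (by omega)
    have e2 := eq_of_intCast_zmod_eq (x := 0) h.2 (by omega) (by omega) (by omega) (by omega)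
    ext <;> omega
  · obtain ⟨s, hs⟩ := exists_natCast_zmod_eq (A.symm r).1
    obtain ⟨t, ht⟩ := exists_natCast_zmod_eq (A.symm r).2
    rw [Finset.mem_Icc] at hs ht
    refine ⟨(s - x₀, t - y₀), ?_, ?_⟩
    · simp only [Set.mem_ofPred_eq, sub_add_cancel]
      omega
    · simp [hs.2, ht.2]
  · have key (u : Site L) (hu : u = e L α ∨ u = -e L α) :
        ∀ r, A (r + u) = A r + e L (τ α) ∨ A (r + u) = A r - e L (τ α) := by
      intro r
      rcases hu with rfl | rfl <;> rcases hA α with h | h <;> simp [h, sub_eq_add_neg]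
    have := key ((d.1 : ZMod L), (d.2 : ZMod L)) (by
      rcases hd with ⟨rfl, rfl | rfl⟩ | ⟨rfl, rfl | rfl⟩ <;> simp [e])
      ((a.1 + x₀ : ℤ), (a.2 + y₀ : ℤ))
    simpa [add_right_comm] using this

end Main

end Vacancy

namespace Vacancy

/-! ### Even permutations from the canonical configuration -/

section Main

open Equiv

variable {L N : ℕ}

theorem connected_permute_of_canonical [NeZero L] {c : Config L N} {A : Site L ≃+ Site L}
    {τ : Perm (Fin 3)} (hA : IsLatticeSymmetry A τ) {m₁ m₂ m₃ : ℤ}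
    (hV : ∀ r α, c.vac (A r) = some (τ α) ↔ r ∈ canonicalSites L m₁ m₂ m₃ α)
    (h₁ : 1 ≤ m₁) (h₃ : m₁ ≤ m₃) (h₂ : m₂ = 0 ∨ m₃ ≤ m₂) (hsum : m₁ + m₂ + m₃ ≤ L - 2)
    (h₀ : m₂ = 0 → 2 * m₃ ≤ L - 2) (hodd : m₂ ≠ 0 → Odd (L - m₂)) {π : Perm (Fin N)}
    (hπ : π ∈ alternatingGroup (Fin N)) : Connected c (c.permute π) := by
  have hchart := isChart_of_isLatticeSymmetry hA m₁ m₃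
  obtain ⟨f, hf⟩ := exists_represents c τ (fun a => A ((a.1 + m₁ : ℤ), (a.2 + m₃ : ℤ)))
    {a | 1 ≤ a.1 + m₁ ∧ a.1 + m₁ ≤ L ∧ 1 ≤ a.2 + m₃ ∧ a.2 + m₃ ≤ L}
  have hinl {X Y : ℤ} {α : Fin 3} (hX : 1 ≤ X + m₁ ∧ X + m₁ ≤ L ∧ 1 ≤ Y + m₃ ∧ Y + m₃ ≤ L)
      (h : (((X + m₁ : ℤ) : ZMod L), ((Y + m₃ : ℤ) : ZMod L)) ∈ canonicalSites L m₁ m₂ m₃ α) :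
      f (X, Y) = .inl α := by
    have hv := (hV _ α).mpr h
    rcases hfX : f (X, Y) with β | j
    · have := hf.vacancy (X, Y) hX β hfX
      rw [hv, Option.some.injEq, EmbeddingLike.apply_eq_iff_eq] at this
      rw [this]
    · have := hf.electron (X, Y) j hfX
      rw [(c.vac_eq_none_iff _).mpr ⟨j, this⟩] at hv
      simp at hv
  have hmem {X Y : ℤ} {α : Fin 3} (hX : 1 ≤ X + m₁ ∧ X + m₁ ≤ L ∧ 1 ≤ Y + m₃ ∧ Y + m₃ ≤ L)
      (h : f (X, Y) = .inl α) :
      (((X + m₁ : ℤ) : ZMod L), ((Y + m₃ : ℤ) : ZMod L)) ∈ canonicalSites L m₁ m₂ m₃ α :=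
    (hV _ α).mp (hf.vacancy (X, Y) hX α h)
  -- After the shift by (m₁, m₃), the 2-vacancies with positive height are those in columns beyond
  -- m₃ + δ and those in columns δ + 1, …, m₃ + δ above height m₁ + δ, where δ = L - m₁ - m₂ - m₃.
  -- The window ends at height L - m₃.
  have hstair : IsStaircase f m₁ m₃ (L - m₁ - m₂ - m₃) (L - m₃) := by
    refine ⟨h₁, h₃, by omega, by omega, by omega, ?_, hf.electronInjective hchart,
      fun X Y _ _ _ _ => ?_, fun X Y _ _ _ _ => ?_, fun X Y _ _ _ _ => ?_,
      fun X Y _ _ _ _ _ _ => ?_⟩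
    -- Failure means δ < m₁ and m₁ + δ ≤ m₃. Equality would give L - m₂ = 2 m₃, which is not odd. So
    -- the site (δ + 1, m₁ + δ + 1) would hold both a 2-vacancy and a 3-vacancy of the block.
    · by_contra! hcon
      have hm₂ : m₂ ≠ 0 := by omega
      obtain ⟨q, hq⟩ := hodd hm₂
      have e1 := hinl (X := L - m₁ - m₂ - m₃ + 1) (Y := L - m₂ - m₃ + 1) (α := 1) (by omega)
        ((intCast_mem_canonicalSites_one_iff (by omega) (by omega) (by omega) (by omega)
          (by omega) (by omega) (by omega)).mpr (by omega))
      have e2 := hinl (X := L - m₁ - m₂ - m₃ + 1) (Y := L - m₂ - m₃ + 1) (α := 2) (by omega)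
        ((intCast_mem_canonicalSites_two_iff (by omega) (by omega) (by omega) (by omega)
          (by omega) (by omega) (by omega) (by omega)).mpr (by omega))
      rw [e1] at e2
      simp at e2
    · exact hinl (by omega) ((intCast_mem_canonicalSites_zero_iff (by omega) (by omega) (by omega)
        (by omega) (by omega) (by omega) (by omega) (by omega)).mpr (by omega))
    · exact hinl (by omega) ((intCast_mem_canonicalSites_two_iff (by omega) (by omega) (by omega)
        (by omega) (by omega) (by omega) (by omega) (by omega)).mpr (by omega))
    · exact hinl (by omega) ((intCast_mem_canonicalSites_two_iff (by omega) (by omega) (by omega)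
        (by omega) (by omega) (by omega) (by omega) (by omega)).mpr (by omega))
    · rcases hfX : f (X, Y) with α | j
      · have h := hmem (by omega) hfX
        exfalso
        match α with
        | 0 =>
          rw [intCast_mem_canonicalSites_zero_iff (by omega) (by omega) (by omega)
            (by omega) (by omega) (by omega) (by omega) (by omega)] at h
          omega
        | 1 =>
          rw [intCast_mem_canonicalSites_one_iff (by omega) (by omega) (by omega) (by omega)
            (by omega) (by omega) (by omega)] at h
          omega
        | 2 =>
          rw [intCast_mem_canonicalSites_two_iff (by omega) (by omega) (by omega)
            (by omega) (by omega) (by omega) (by omega) (by omega)] at h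
          omega
      · exact ⟨j, rfl⟩
  refine hf.connected_permute hchart (hstair.alternatingGroup_le (fun j => ?_) hπ)
  obtain ⟨⟨X, Y⟩, hbox, -, hj⟩ := hf.exists_eq_inr hchart j
  have hbox : 1 ≤ X + m₁ ∧ X + m₁ ≤ L ∧ 1 ≤ Y + m₃ ∧ Y + m₃ ≤ L := hbox
  have hnot (α : Fin 3) :
      (((X + m₁ : ℤ) : ZMod L), ((Y + m₃ : ℤ) : ZMod L)) ∉ canonicalSites L m₁ m₂ m₃ α := by
    intro h
    have := hinl hbox h
    rw [hj] at this
    simp at this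
  have n0 := hnot 0
  have n1 := hnot 1
  have n2 := hnot 2
  rw [intCast_mem_canonicalSites_zero_iff (by omega) (by omega) (by omega) (by omega) (by omega)
    (by omega) (by omega) (by omega)] at n0
  rw [intCast_mem_canonicalSites_one_iff (by omega) (by omega) (by omega) (by omega) (by omega)
    (by omega) (by omega)] at n1
  rw [intCast_mem_canonicalSites_two_iff (by omega) (by omega) (by omega) (by omega) (by omega)
    (by omega) (by omega) (by omega)] at n2
  exact ⟨X, Y, by omega, by omega, by omega, by omega, by omega, by omega, hj⟩

end Main

end Vacancy

theorem mainTheorem9 (L N : ℕ) (m : Fin 3 → ℕ) (c₀ c : Vacancy.Config L N)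
    (hcanonical : Vacancy.IsCanonical m c₀.vac)
    (hsector : Vacancy.Connected c₀ c)
    (ha : ∀ α : Fin 3, ∀ l ∈ Finset.Icc 1 L, Vacancy.lineCount c.vac α l = m α)
    (hb : ∀ α : Fin 3, m α ≠ 0 → Odd ((L : ℤ) - m α))
    (hc : 2 ≤ (Finset.univ.filter fun α : Fin 3 => m α ≠ 0).card)
    (hc' : (Finset.univ.filter fun α : Fin 3 => m α ≠ 0).card = 2 →
      ∀ α : Fin 3, 2 * (m α : ℤ) ≤ (L : ℤ) - 2)
    (hd : ∑ α : Fin 3, (m α : ℤ) ≤ (L : ℤ) - 2) :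
    Vacancy.EvenPermutationErgodic c := by
  have hL : 1 < L := by
    have : 0 ≤ ∑ α : Fin 3, (m α : ℤ) := Finset.sum_nonneg fun _ _ => by positivity
    omega
  have : NeZero L := ⟨by omega⟩
  intro π
  refine ⟨fun h => Vacancy.mem_alternatingGroup_of_connected_permute hL h hb ha, fun hπ => ?_⟩
  obtain ⟨A, τ, hA, horder, hV⟩ := hcanonical
  have hsum : (m (τ 0) : ℤ) + m (τ 1) + m (τ 2) ≤ L - 2 := by
    rw [← Equiv.sum_comp τ, Fin.sum_univ_three] at hd
    exact hd
  have hcard : m (τ 1) = 0 → 1 ≤ m (τ 0) → 1 ≤ m (τ 2) →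
      (Finset.univ.filter fun α : Fin 3 => m α ≠ 0).card = 2 := by
    intro h1 h0 h2
    have : (Finset.univ.filter fun α : Fin 3 => m α ≠ 0) = {τ 0, τ 2} := by
      ext α
      obtain ⟨β, rfl⟩ := τ.surjective α
      match β with
      | 0 => simp; omega
      | 1 => simp [h1]
      | 2 => simp; omega
    rw [this, Finset.card_pair (by simp)]
  have hcon : Vacancy.Connected c₀ (c₀.permute π) := by
    simp only [Vacancy.CanonicalOrder] at horder
    have h3 := fun h h' h'' => hc' (hcard h h' h'') (τ 2)
    exact Vacancy.connected_permute_of_canonical hA hV (by omega) (by omega) (by omega) hsum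
      (fun h => h3 (by omega) (by omega) (by omega)) (fun h => hb _ (by exact_mod_cast h)) hπ
  -- Back to the canonical configuration, the permutation there, and out again along the relabelled
  -- path.
  exact (hsector.symm.trans hcon).trans (hsector.permute π)
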